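/- **Affine Euler–Poincaré theorem for vertical slice models.** Let $M\subseteq\mathbb R^2$ be a closed set in which its interior is dense, with Lebesgue measure $d^2x$, and let $s\in\mathbb R$. Smooth fields on $M$ (and families of fields depending on parameters) are restrictions of smooth maps on the whole plane (times the parameter space). Let $\mathcal F(M)$ be the smooth functions on $M$, $\operatorname{Den}(M)$ the smooth densities $D\,d^2x$, and $\mathfrak X(M)$ the smooth vector fields on $M$ tangent to the boundary, i.e. $u(p)\cdot(y-p)=0$ whenever $p\in M$ is a point of $M$ nearest to $y\in\mathbb R^2$. Let $S=\operatorname{Diff}(M)\ltimes\mathcal F(M)$ with product $(\phi_1,v_1)(\phi_2,v_2)=(\phi_1\phi_2,\,v_1\circ\phi_2+v_2)$ and one-cocycle $c(\phi,v)=sv$, and $\mathfrak s=\mathfrak X(M)\ltimes\mathcal F(M)$ with $$\operatorname{ad}_{(u_S,u_T)}(v_S,v_T)=\big(\operatorname{ad}_{u_S}v_S,\ \mathcal L_{v_S}u_T-\mathcal L_{u_S}v_T\big),\qquad \operatorname{ad}_{u}v=-(u\cdot\nabla v-v\cdot\nabla u).$$ Here $\mathcal L_va=v\cdot\nabla a$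 for functions and $\mathcal L_v(D\,d^2x)=\nabla\cdot(Dv)\,d^2x$ for densities. For one-form densities $m$ put $\operatorname{ad}^*_um=u\cdot\nabla m+(\nabla u)^{T}m+(\nabla\cdot u)\,m$; for a density $b$ and a function $a$ put $b\diamond a=-b\,\nabla a$; for a function $b$ and a density $D$ put $b\diamond D=D\,\nabla b$. Pairings $\langle\cdot,\cdot\rangle$ are integrals over $M$. 1. *(Constrained variations.)* Let $(\phi_{\epsilon,t},v_{\epsilon,t})$ be a smooth two-parameter family in $S$ ($\phi$, $\phi^{-1}$ and $v$ smooth jointly in the parameters and the point), $D_0\,d^2x\in\operatorname{Den}(M)$ and $\vartheta_0\in\mathcal F(M)$. Then $$(u_S,u_T)=(\dot\phi\,\phi^{-1},\ \phi_*\dot v),\qquad D\,d^2x=\phi_*(D_0\,d^2x),\qquad \vartheta_s=\phi_*\vartheta_0+c((\phi,v)^{-1})=\phi_*\vartheta_0-s\,\phi_*v$$ define a smooth family in $(\mathfrak X(M)\ltimes\mathcal F(M))\times\operatorname{Den}(M)\times\mathcal F(M)$, $(v_S,v_T)=(\delta\phi\,\phi^{-1},\phi_*\delta v)$ is a smooth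 curve in $\mathfrak s$, where $\delta=\partial_\epsilon|_{\epsilon=0}$, and $$\delta(u_S,u_T)=\partial_t(v_S,v_T)-\operatorname{ad}_{(u_S,u_T)}(v_S,v_T),\quad \delta D=-\mathcal L_{v_S}D,\quad \delta\vartheta_s=-\mathcal L_{v_S}\vartheta_s-s\,v_T.\tag{$*$}$$ 2. *(Duality.)* For $u,v\in\mathfrak X(M)$ with $v$ of bounded support, $\langle\operatorname{ad}^*_um,v\rangle=\langle m,\operatorname{ad}_uv\rangle$ for all smooth one-form densities $m$, and $-\langle b\diamond a,v\rangle=\langle\mathcal L_va,b\rangle$ for both kinds of diamond. 3. *(Affine Euler–Poincaré equations.)* Let $\ell:(\mathfrak X(M)\ltimes\mathcal F(M))\times\operatorname{Den}(M)\times\mathcal F(M)\to\mathbb R$, let $t_0<t_1$, and let $q(t)=(u_S,u_T,D,\vartheta_s)(t)$ be a smooth curve. Call a smooth family $q_\epsilon(t)$ with $q_0=q$ that differs from $q$ only in a bounded region of $M$ a deformation of $q$. Assume that $\ell(q_\epsilon(t))$ is $C^1$ in $(\epsilon,t)$ near $\{0\}\times[t_0,t_1]$ for every deformation, and that $\ell$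 has, at $q(t)$ for $t\in[t_0,t_1]$, variational derivatives $\frac{\delta\ell}{\delta u_S}$ (a one-form density), $\frac{\delta\ell}{\delta u_T}$, $\frac{\delta\ell}{\delta\vartheta_s}$ (densities) and $\frac{\delta\ell}{\delta D}$ (a function), depending smoothly on $(t,x)$; that is, the derivative of $\ell$ at $q(t)$ along every smooth curve through $q(t)$ that changes it only in a bounded region is the sum of the pairings of these with the components of the velocity of the curve. Then Hamilton's principle $$\frac{d}{d\epsilon}\Big|_{\epsilon=0}\int_{t_0}^{t_1}\ell(q_\epsilon(t))\,dt=0,$$ for all deformations whose infinitesimal variation on $[t_0,t_1]$ has the form $(*)$ for some smooth curve $(v_S,v_T)$ in $\mathfrak s$ that vanishes at $t_0$ and $t_1$ and has bounded support in space (automatic if $M$ is bounded), holds if and only if on $[t_0,t_1]\times M$ $$(\partial_t+\operatorname{ad}^*_{u_S})\frac{\delta\ell}{\delta u_S}=\frac{\delta\ell}{\delta u_T}\diamond u_T+\frac{\delta\ell}{\delta D}\diamond D+\frac{\delta\ell}{\delta\vartheta_s}\diamond\vartheta_s,\qquad (\partial_t+\mathcal L_{u_S})\frac{\delta\ell}{\delta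 u_T}=-s\,\frac{\delta\ell}{\delta\vartheta_s}.$$ -/

import Mathlib

open MeasureTheory Set
open scoped ContDiff

noncomputable section

namespace VSM

/-- The plane that contains the slice, with coordinates `(x, z)`. -/
abbrev Plane := EuclideanSpace ℝ (Fin 2)

/-! ### Smooth fields on the slice

The slice is a closed set `M` in which the interior is dense. A field on `M` is smooth (up to the
boundary) if it is the restriction of a smooth map defined on the whole plane. -/

/-- Smooth `F`-valued fields on `M`. -/
def Smooth (M : Set Plane) (F : Type*) [NormedAddCommGroup F] [NormedSpace ℝ F] :
    Submodule ℝ (M → F) where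
  carrier := {f | ∃ g : Plane → F, ContDiff ℝ ∞ g ∧ ∀ x : M, f x = g x}
  add_mem' := by
    rintro f₁ f₂ ⟨g₁, h₁, e₁⟩ ⟨g₂, h₂, e₂⟩
    exact ⟨fun x => g₁ x + g₂ x, h₁.add h₂, fun x => by simp [e₁, e₂]⟩
  zero_mem' := ⟨fun _ => 0, contDiff_const, fun _ => rfl⟩
  smul_mem' := by
    rintro c f ⟨g, h, e⟩
    exact ⟨fun x => c • g x, contDiff_const.smul h, fun x => by simp [e]⟩

/-- `𝓕(M)`: smooth functions on `M`. -/
abbrev Fun (M : Set Plane) := Smooth M ℝ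

/-- `Den(M)`: smooth densities `D d²x` on `M`, given by their coefficient `D`. -/
abbrev Den (M : Set Plane) := Smooth M ℝ

/-- Smooth one-form densities `m ⊗ d²x` on `M`, given by their coefficient `m`. -/
abbrev OneFormDen (M : Set Plane) := Smooth M (Plane →L[ℝ] ℝ)

/-- `𝔛(M)`: smooth vector fields on `M` that are tangent to the boundary, that is, orthogonal at
every `p ∈ M` to every exterior normal `y - p`, where `p` is a point of `M` nearest to `y`. At
interior points the condition is empty. -/
def Vec (M : Set Plane) : Submodule ℝ (Smooth M Plane) where
  carrier := {u | ∀ (p : M) (y : Plane), (∀ z ∈ M, dist y p ≤ dist y z) →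
    inner ℝ ((u : M → Plane) p) (y - p) = 0}
  add_mem' := by
    intro u v hu hv p y h
    simp [inner_add_left, hu p y h, hv p y h]
  zero_mem' := by
    intro p y h
    simp
  smul_mem' := by
    intro c u hu p y h
    simp [inner_smul_left, hu p y h]

/-- `𝔰 = 𝔛(M) ⋉ 𝓕(M)`, elements `(u_S, u_T)`. -/
abbrev Alg (M : Set Plane) := Vec M × Fun M

section Calculus

variable {M : Set Plane} {F : Type*} [NormedAddCommGroup F] [NormedSpace ℝ F]

/-- The value of a smooth field at a point. -/
def val (a : Smooth M F) (x : M) : F := (a : M → F) x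

/-- The value of a vector field at a point. -/
def vval (u : Vec M) (x : M) : Plane := val (u : Smooth M Plane) x

/-- The derivative of a smooth field at a point of `M`, boundary points included: the derivative
of a smooth extension. -/
def d (a : Smooth M F) (x : M) : Plane →L[ℝ] F := fderiv ℝ a.2.choose x

/-- The derivative does not depend on the extension, since the interior of `M` is dense in `M`. -/
theorem d_eq (hM : M ⊆ closure (interior M)) (a : Smooth M F) (g : Plane → F)
    (hg : ContDiff ℝ ∞ g) (h : ∀ x : M, val a x = g x) (x : M) : d a x = fderiv ℝ g x := by
  have h1 := a.2.choose_spec.1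
  have h2 := a.2.choose_spec.2
  have hc : IsClosed {y : Plane | fderiv ℝ a.2.choose y = fderiv ℝ g y} :=
    isClosed_eq (h1.continuous_fderiv (by simp)) (hg.continuous_fderiv (by simp))
  have hi : interior M ⊆ {y : Plane | fderiv ℝ a.2.choose y = fderiv ℝ g y} := by
    intro y hy
    apply Filter.EventuallyEq.fderiv_eq
    filter_upwards [isOpen_interior.mem_nhds hy] with z hz
    have hz' : z ∈ M := interior_subset hz
    exact (h2 ⟨z, hz'⟩).symm.trans (h ⟨z, hz'⟩)
  exact closure_minimal hi hc (hM x.2)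

/-- The derivative of a vector field. -/
def dv (u : Vec M) (x : M) : Plane →L[ℝ] Plane := d (u : Smooth M Plane) x

/-- The divergence of a vector field. -/
def div (u : Vec M) (x : M) : ℝ :=
  ∑ i : Fin 2, dv u x (EuclideanSpace.single i 1) i

/-- The Lie derivative `𝓛_v a` of a function. -/
def lieFun (v : Vec M) (a : Fun M) (x : M) : ℝ := d a x (vval v x)

/-- The Lie derivative `𝓛_v (D d²x) = div (D v) d²x` of a density. -/
def lieDen (v : Vec M) (D : Den M) (x : M) : ℝ :=
  d D x (vval v x) + val D x * div v x

/-- The commutator `u · ∇ v - v · ∇ u` of vector fields. -/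
def bracket (u v : Vec M) (x : M) : Plane := dv v x (vval u x) - dv u x (vval v x)

/-- The adjoint action `ad_u v` of the Lie algebra of `Diff(M)`, minus the commutator. -/
def adVec (u v : Vec M) (x : M) : Plane := - bracket u v x

/-- The adjoint action of `𝔰` on itself,
`ad_{(u_S,u_T)} (v_S,v_T) = (ad_{u_S} v_S, 𝓛_{v_S} u_T - 𝓛_{u_S} v_T)`. -/
def ad (u v : Alg M) : (M → Plane) × (M → ℝ) :=
  (adVec u.1 v.1, fun x => lieFun v.1 u.2 x - lieFun u.1 v.2 x)

/-- The coadjoint action `ad*_u m` on one-form densities. -/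
def adStar (u : Vec M) (m : OneFormDen M) (x : M) : Plane →L[ℝ] ℝ :=
  d m x (vval u x) + (val m x).comp (dv u x) + div u x • val m x

/-- The diamond `b ⋄ a` of a density `b` and a function `a`. -/
def diamondFun (b : Den M) (a : Fun M) (x : M) : Plane →L[ℝ] ℝ :=
  - (val b x • d a x)

/-- The diamond `b ⋄ D` of a function `b` and a density `D`. -/
def diamondDen (b : Fun M) (D : Den M) (x : M) : Plane →L[ℝ] ℝ :=
  val D x • d b x

/-- Lebesgue measure on `M`. -/
def area (M : Set Plane) : Measure M := Measure.comap Subtype.val volume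

/-- The pairing of one-form densities with vector fields. -/
def pairVec (m : M → (Plane →L[ℝ] ℝ)) (v : M → Plane) : ℝ := ∫ x, m x (v x) ∂(area M)

/-- The pairing of functions with densities. -/
def pairFun (b a : M → ℝ) : ℝ := ∫ x, b x * a x ∂(area M)

/-- Vector fields with bounded support; on a bounded `M`, all of them. -/
def BddSupp (v : Vec M) : Prop := ∃ R : ℝ, ∀ x : M, R < ‖(x : Plane)‖ → vval v x = 0

/-- A family of smooth fields that depends smoothly on a parameter, jointly with the point. -/
def SmoothFamily {P : Type*} [NormedAddCommGroup P] [NormedSpace ℝ P] (f : P → M → F) : Prop :=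
  ∃ g : P × Plane → F, ContDiff ℝ ∞ g ∧ ∀ (p : P) (x : M), f p x = g (p, (x : Plane))

end Calculus

/-! ### The semidirect-product group and the one-cocycle -/

theorem Smooth.comp_mem {M : Set Plane} {F : Type*} [NormedAddCommGroup F] [NormedSpace ℝ F]
    {a : M → F} (ha : a ∈ Smooth M F) {f : M → M}
    (hf : (fun x => (f x : Plane)) ∈ Smooth M Plane) : (fun x => a (f x)) ∈ Smooth M F := by
  obtain ⟨g, hg, e⟩ := ha
  obtain ⟨k, hk, e'⟩ := hf
  refine ⟨fun x => g (k x), hg.comp hk, fun x => ?_⟩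
  have h := e' x
  simp only at h ⊢
  rw [e, h]

/-- `S = Diff(M) ⋉ 𝓕(M)`: pairs `(φ, v)` of a diffeomorphism of `M` and a smooth function. -/
@[ext]
structure SliceGroup (M : Set Plane) where
  φ : M ≃ M
  v : M → ℝ
  smooth_φ : (fun x => (φ x : Plane)) ∈ Smooth M Plane
  smooth_symm : (fun x => (φ.symm x : Plane)) ∈ Smooth M Plane
  smooth_v : v ∈ Smooth M ℝ

namespace SliceGroup

variable {M : Set Plane}

/-- `(φ₁, v₁) (φ₂, v₂) = (φ₁ φ₂, v₁ φ₂ + v₂)`. -/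
instance : Mul (SliceGroup M) where
  mul g h :=
    { φ := h.φ.trans g.φ
      v := fun x => g.v (h.φ x) + h.v x
      smooth_φ := Smooth.comp_mem g.smooth_φ h.smooth_φ
      smooth_symm := Smooth.comp_mem h.smooth_symm g.smooth_symm
      smooth_v := (Smooth M ℝ).add_mem (Smooth.comp_mem g.smooth_v h.smooth_φ) h.smooth_v }

instance : One (SliceGroup M) where
  one :=
    { φ := Equiv.refl M
      v := 0
      smooth_φ := ⟨id, contDiff_id, fun _ => rfl⟩
      smooth_symm := ⟨id, contDiff_id, fun _ => rfl⟩
      smooth_v := (Smooth M ℝ).zero_mem }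

instance : Inv (SliceGroup M) where
  inv g :=
    { φ := g.φ.symm
      v := fun x => - g.v (g.φ.symm x)
      smooth_φ := g.smooth_symm
      smooth_symm := g.smooth_φ
      smooth_v := (Smooth M ℝ).neg_mem (Smooth.comp_mem g.smooth_v g.smooth_symm) }

theorem mul_φ (g h : SliceGroup M) : (g * h).φ = h.φ.trans g.φ := rfl
theorem mul_v (g h : SliceGroup M) (x : M) : (g * h).v x = g.v (h.φ x) + h.v x := rfl
theorem one_φ : (1 : SliceGroup M).φ = Equiv.refl M := rfl
theorem one_v (x : M) : (1 : SliceGroup M).v x = 0 := rfl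
theorem inv_φ (g : SliceGroup M) : g⁻¹.φ = g.φ.symm := rfl
theorem inv_v (g : SliceGroup M) (x : M) : g⁻¹.v x = - g.v (g.φ.symm x) := rfl

instance : Group (SliceGroup M) :=
  Group.ofLeftAxioms
    (fun a b c => by
      apply SliceGroup.ext
      · rfl
      · funext x
        simp [mul_v, mul_φ, add_assoc])
    (fun a => by
      apply SliceGroup.ext
      · rfl
      · funext x
        simp [mul_v, one_v])
    (fun a => by
      apply SliceGroup.ext
      · simp [mul_φ, inv_φ, one_φ]
      · funext x
        simp [mul_v, inv_v, one_v])

/-- The derivative of the diffeomorphism `φ` at a point of `M`. -/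
def dφ (g : SliceGroup M) (x : M) : Plane →L[ℝ] Plane :=
  d (⟨fun y => (g.φ y : Plane), g.smooth_φ⟩ : Smooth M Plane) x

/-- The one-cocycle `c(φ, v) = s v`. -/
def cocycle (s : ℝ) (g : SliceGroup M) (x : M) : ℝ := s * g.v x

end SliceGroup

/-- A family in `S` that depends smoothly on a parameter: `φ`, `φ⁻¹` and `v` do. -/
def SmoothGroupFamily {M : Set Plane} {P : Type*} [NormedAddCommGroup P] [NormedSpace ℝ P]
    (g : P → SliceGroup M) : Prop :=
  SmoothFamily (fun p (x : M) => ((g p).φ x : Plane)) ∧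
  SmoothFamily (fun p (x : M) => ((g p).φ.symm x : Plane)) ∧
  SmoothFamily (fun p (x : M) => (g p).v x)

/-! ### States, variations and the reduced Lagrangian -/

/-- A point `(u_S, u_T, D, ϑ_s)` of `(𝔛(M) ⋉ 𝓕(M)) × Den(M) × 𝓕(M)`. -/
structure State (M : Set Plane) where
  u : Alg M
  D : Den M
  θ : Fun M

/-- Variations `(δu_S, δu_T, δD, δϑ_s)`. -/
structure Variation (M : Set Plane) where
  uS : M → Plane
  uT : M → ℝ
  D : M → ℝ
  θ : M → ℝ

/-- Values `(δℓ/δu_S, δℓ/δu_T, δℓ/δD, δℓ/δϑ_s)` of the variational derivatives: a one-form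
density, a density, a function and a density. -/
structure Costate (M : Set Plane) where
  uS : OneFormDen M
  uT : Den M
  D : Fun M
  θ : Den M

section Variational

variable {M : Set Plane} {P : Type*} [NormedAddCommGroup P] [NormedSpace ℝ P]

def SmoothStateFamily (q : P → State M) : Prop :=
  SmoothFamily (fun p => vval (q p).u.1) ∧ SmoothFamily (fun p => val (q p).u.2) ∧
  SmoothFamily (fun p => val (q p).D) ∧ SmoothFamily (fun p => val (q p).θ)

def SmoothCostateFamily (μ : P → Costate M) : Prop :=
  SmoothFamily (fun p => val (μ p).uS) ∧ SmoothFamily (fun p => val (μ p).uT) ∧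
  SmoothFamily (fun p => val (μ p).D) ∧ SmoothFamily (fun p => val (μ p).θ)

def SmoothAlgFamily (v : P → Alg M) : Prop :=
  SmoothFamily (fun p => vval (v p).1) ∧ SmoothFamily (fun p => val (v p).2)

/-- Equality of two states at a point. -/
def EqAt (c c' : State M) (x : M) : Prop :=
  vval c.u.1 x = vval c'.u.1 x ∧ val c.u.2 x = val c'.u.2 x ∧
  val c.D x = val c'.D x ∧ val c.θ x = val c'.θ x

/-- The velocity of a curve of states. -/
def velocity (C : ℝ → State M) (e : ℝ) : Variation M where
  uS x := deriv (fun r => vval (C r).u.1 x) e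
  uT x := deriv (fun r => val (C r).u.2 x) e
  D x := deriv (fun r => val (C r).D x) e
  θ x := deriv (fun r => val (C r).θ x) e

/-- The pairing of variational derivatives with variations. -/
def pairing (μ : Costate M) (w : Variation M) : ℝ :=
  pairVec (val μ.uS) w.uS + pairFun (val μ.uT) w.uT + pairFun (val μ.D) w.D +
    pairFun (val μ.θ) w.θ

/-- `μ` is the variational derivative of `ℓ` at the state `c`: along every smooth curve of states
through `c` that moves `c` only in a bounded region, the derivative of `ℓ` is the pairing of `μ`
with the velocity. -/
def IsVariationalDerivative (ℓ : State M → ℝ) (c : State M) (μ : Costate M) : Prop :=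
  ∀ C : ℝ → State M, SmoothStateFamily C → C 0 = c →
    (∃ R : ℝ, ∀ (e : ℝ) (x : M), R < ‖(x : Plane)‖ → EqAt (C e) c x) →
    HasDerivAt (fun e => ℓ (C e)) (pairing μ (velocity C 0)) 0

/-- A smooth deformation `Q (ε, t)`, in a bounded region, of a curve of states `q t = Q (0, t)`. -/
def IsDeformation (q : ℝ → State M) (Q : ℝ × ℝ → State M) : Prop :=
  SmoothStateFamily Q ∧ (∀ t, Q (0, t) = q t) ∧
  ∃ R : ℝ, ∀ (p : ℝ × ℝ) (x : M), R < ‖(x : Plane)‖ → EqAt (Q p) (q p.2) x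

/-- `ℓ` is continuously differentiable along the smooth deformations of the curve `q`. -/
def IsC1Along (ℓ : State M → ℝ) (t₀ t₁ : ℝ) (q : ℝ → State M) : Prop :=
  ∀ Q : ℝ × ℝ → State M, IsDeformation q Q →
    ∀ t ∈ Icc t₀ t₁, ContDiffAt ℝ 1 (fun p => ℓ (Q p)) (0, t)

/-- The constrained variation of the curve `q` generated by the curve `v = (v_S, v_T)` in `𝔰`:
`δ(u_S, u_T) = ∂ₜ (v_S, v_T) - ad_{(u_S, u_T)} (v_S, v_T)`, `δD = - 𝓛_{v_S} D`,
`δϑ_s = - 𝓛_{v_S} ϑ_s - s v_T`. -/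
def constrainedVariation (s : ℝ) (q : ℝ → State M) (v : ℝ → Alg M) (t : ℝ) :
    Variation M where
  uS x := deriv (fun τ => vval (v τ).1 x) t - (ad (q t).u (v t)).1 x
  uT x := deriv (fun τ => val (v τ).2 x) t - (ad (q t).u (v t)).2 x
  D x := - lieDen (v t).1 (q t).D x
  θ x := - lieFun (v t).1 (q t).θ x - s * val (v t).2 x

/-- Admissible generators of variations: smooth curves in `𝔰` that vanish at the end times, with
bounded support in space. -/
def IsAdmissible (t₀ t₁ : ℝ) (v : ℝ → Alg M) : Prop :=
  SmoothAlgFamily v ∧ v t₀ = 0 ∧ v t₁ = 0 ∧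
  ∃ R : ℝ, ∀ (t : ℝ) (x : M), R < ‖(x : Plane)‖ → vval (v t).1 x = 0 ∧ val (v t).2 x = 0

/-- Hamilton's principle `δ ∫ ℓ dt = 0` with constrained variations: the action is stationary
along every deformation of `q` whose infinitesimal variation is generated by an admissible
curve in `𝔰`. -/
def HamiltonPrinciple (s : ℝ) (ℓ : State M → ℝ) (t₀ t₁ : ℝ) (q : ℝ → State M) : Prop :=
  ∀ (Q : ℝ × ℝ → State M) (v : ℝ → Alg M), IsDeformation q Q → IsAdmissible t₀ t₁ v →
    (∀ t ∈ Icc t₀ t₁, velocity (fun e => Q (e, t)) 0 = constrainedVariation s q v t) →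
    HasDerivAt (fun e => ∫ t in t₀..t₁, ℓ (Q (e, t))) 0 0

/-- The affine Euler–Poincaré equations for the curve `q`, with variational derivatives `μ`. -/
def AffineEulerPoincare (s t₀ t₁ : ℝ) (q : ℝ → State M) (μ : ℝ → Costate M) : Prop :=
  ∀ t ∈ Icc t₀ t₁, ∀ x : M,
    deriv (fun τ => val (μ τ).uS x) t + adStar (q t).u.1 (μ t).uS x =
      diamondFun (μ t).uT (q t).u.2 x + diamondDen (μ t).D (q t).D x +
        diamondFun (μ t).θ (q t).θ x ∧
    deriv (fun τ => val (μ τ).uT x) t + lieDen (q t).u.1 (μ t).uT x = - (val (μ t).θ x * s)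

/-- The curve of states defined by a curve `(φ, v)` in `S` and initial data `D₀`, `ϑ₀`:
`u_S = φ̇ φ⁻¹`, `u_T = φ_* v̇`, `D d²x = φ_* (D₀ d²x)`, and `ϑ_s = φ_* ϑ₀ + c((φ, v)⁻¹)`. -/
def IsInducedBy (s : ℝ) (D₀ : Den M) (θ₀ : Fun M) (g : ℝ → SliceGroup M)
    (q : ℝ → State M) : Prop :=
  ∀ (t : ℝ) (x : M),
    vval (q t).u.1 ((g t).φ x) = deriv (fun τ => ((g τ).φ x : Plane)) t ∧
    val (q t).u.2 ((g t).φ x) = deriv (fun τ => (g τ).v x) t ∧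
    val (q t).D ((g t).φ x) * ((g t).dφ x).det = val D₀ x ∧
    val (q t).θ x = val θ₀ ((g t).φ.symm x) + SliceGroup.cocycle s (g t)⁻¹ x

/-- The generator `(v_S, v_T) = (δφ φ⁻¹, φ_* δv)` of a variation `g (ε, t)` of a curve in `S`. -/
def IsGenerator (g : ℝ × ℝ → SliceGroup M) (v : ℝ → Alg M) : Prop :=
  ∀ (t : ℝ) (x : M),
    vval (v t).1 ((g (0, t)).φ x) = deriv (fun e => ((g (e, t)).φ x : Plane)) 0 ∧
    val (v t).2 ((g (0, t)).φ x) = deriv (fun e => (g (e, t)).v x) 0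

end Variational

end VSM

end

noncomputable section

namespace VSM

section Divergence

open Filter Topology Metric
open scoped NNReal

/-! ### The divergence theorem for fields tangent to a closed set -/

/-! Fields on `M` are replaced by smooth extensions to the plane. The interior is dense in `M`, so
first derivatives at points of `M` do not depend on the extension. All calculus can therefore be
done with `fderiv` on the plane, while tangency and the relations between a diffeomorphism and its
inverse are used on `M` only.

The boundary of `M` may be rough, so integration by parts rests on `setIntegral_planeDiv_eq_zero`.
The indicator of `M` is approximated by Lipschitz cutoffs of the distance to `M`. Their gradients
have size `c` on a collar of width `1/c`, but point along proximal normals, to which a tangent field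
is orthogonal up to an error of order `1/c`. The boundary term thus stays bounded on a collar that
shrinks to nothing, and vanishes in the limit. Both nontrivial dualities are this theorem applied to
a scalar multiple of a tangent field.

For the constrained variations, let `k` be `φ` or `v` and consider the field `(∂_b k) ∘ φ⁻¹`
(`pushDeriv`). Its derivative in the parameter direction `a`, taken along the trajectories, is `(∂_a
∂_b k) ∘ φ⁻¹`, which is symmetric in `a` and `b`. With `a` the deformation parameter and `b` time,
this symmetry (`fderiv_pushDeriv_comm`) is the formula for the variation of `(u_S, u_T)`. The
density obeys a continuity equation by Jacobi's formula, and along trajectories `ϑ_s` is `ϑ₀ - s v`.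

For Hamilton's principle, the product rule (`pairing_integrand_eq`) writes the integrand of the
varied action as the time derivative of momentum paired with generator, minus the residuals of the
two equations paired with the generator, plus divergences of multiples of `u_S` and `v_S`. The
divergences integrate to zero by tangency, and the time derivative does so because the generator
vanishes at the end times. What remains is `intervalIntegral_pairing`, which gives one implication
at once. For the converse, Hamilton's principle restricts only the infinitesimal variation, so
straight lines `q + ε w` suffice as deformations. Generators supported in `(t₀, t₁) × interior M`
are free test fields, the fundamental lemma makes the residuals vanish there, and continuity extends
this to `[t₀, t₁] × M`. -/

theorem sum_apply_single_mul (A : Plane →L[ℝ] ℝ) (w : Plane) :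
    ∑ i : Fin 2, A (EuclideanSpace.single i 1) * w i = A w := by
  have hw : w = ∑ i, w i • EuclideanSpace.single i (1 : ℝ) := by
    ext j
    fin_cases j <;> simp
  conv_rhs => rw [hw, map_sum]
  exact Finset.sum_congr rfl fun i _ => by rw [map_smul, smul_eq_mul, mul_comm]

/-- The divergence of a vector field defined on the whole plane. -/
def planeDiv (W : Plane → Plane) (x : Plane) : ℝ :=
  ∑ i : Fin 2, fderiv ℝ W x (EuclideanSpace.single i 1) i

/-- A vector field on the plane is tangent to `M` if it is orthogonal to all proximal normals. -/
def TangentTo (M : Set Plane) (W : Plane → Plane) : Prop :=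
  ∀ p ∈ M, ∀ y : Plane, (∀ z ∈ M, dist y p ≤ dist y z) → inner ℝ (W p) (y - p) = 0

/-- A Lipschitz cutoff function equal to `1` on `M` and to `0` at distance at least `c⁻¹`. -/
def collar (M : Set Plane) (c : ℝ≥0) (y : Plane) : ℝ := max 0 (1 - c * infDist y M)

theorem lipschitzWith_collar (M : Set Plane) (c : ℝ≥0) : LipschitzWith c (collar M c) := by
  have h : LipschitzWith c fun y => 1 - (c : ℝ) * infDist y M := by
    refine LipschitzWith.of_dist_le_mul fun x y => ?_
    have h1 := (lipschitz_infDist_pt M).dist_le_mul x y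
    simp only [Real.dist_eq, NNReal.coe_one, one_mul] at h1 ⊢
    have : 1 - (c : ℝ) * infDist x M - (1 - c * infDist y M)
        = - (c * (infDist x M - infDist y M)) := by ring
    rw [this, abs_neg, abs_mul, NNReal.abs_eq]
    gcongr
  exact (LipschitzWith.const_max h 0)

theorem collar_nonneg (M : Set Plane) (c : ℝ≥0) (y : Plane) : 0 ≤ collar M c y := le_max_left _ _

theorem collar_le_one (M : Set Plane) (c : ℝ≥0) (y : Plane) : collar M c y ≤ 1 := by
  have : 0 ≤ (c : ℝ) * infDist y M := by positivity [infDist_nonneg (x := y) (s := M)]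
  exact max_le zero_le_one (by linarith)

theorem collar_eq_one {M : Set Plane} (c : ℝ≥0) {y : Plane} (h : infDist y M = 0) :
    collar M c y = 1 := by simp [collar, h]

theorem collar_eq_zero {M : Set Plane} {c : ℝ≥0} {y : Plane} (h : 1 ≤ c * infDist y M) :
    collar M c y = 0 := max_eq_left (by linarith)

/-- The values `1` and `0` are global extrema of the cutoff. No differentiability is needed, since
`fderiv` is `0` by default where it fails. -/
theorem fderiv_collar_eq_zero {M : Set Plane} {c : ℝ≥0} {y : Plane}
    (h : infDist y M = 0 ∨ 1 ≤ c * infDist y M) : fderiv ℝ (collar M c) y = 0 := by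
  rcases h with h | h
  · refine IsLocalMax.fderiv_eq_zero (Eventually.of_forall fun z => ?_)
    rw [collar_eq_one c h]
    exact collar_le_one M c z
  · refine IsLocalMin.fderiv_eq_zero (Eventually.of_forall fun z => ?_)
    rw [collar_eq_zero h]
    exact collar_nonneg M c z

/-- The bound does not depend on `c`. In the collar the gradient has size `c` and points along `y -
p` with `p` a nearest point of `M`. There `W p` has no component, so only `W y - W p` counts, which
is at most `L ‖y - p‖`, and `c ‖y - p‖ < 1`. -/
theorem abs_fderiv_collar_le {M : Set Plane} (hM : IsClosed M) (hne : M.Nonempty) {W : Plane → Plane}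
    {L : ℝ≥0} (hL : LipschitzWith L W) (hW : TangentTo M W) {c : ℝ≥0} {y : Plane}
    (hd : DifferentiableAt ℝ (collar M c) y) : |fderiv ℝ (collar M c) y (W y)| ≤ L := by
  by_cases h : infDist y M = 0 ∨ 1 ≤ c * infDist y M
  · simp [fderiv_collar_eq_zero h]
  push Not at h
  obtain ⟨h0, h1⟩ := h
  obtain ⟨p, hp, hyp⟩ := hM.exists_infDist_eq_dist hne y
  have hmin : ∀ z ∈ M, dist y p ≤ dist y z := fun z hz => hyp ▸ infDist_le_dist_of_mem hz
  have hpos : 0 < ‖y - p‖ := by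
    rw [← dist_eq_norm, ← hyp]
    exact lt_of_le_of_ne infDist_nonneg (Ne.symm h0)
  -- The cone `k` lies below the collar function everywhere and touches it at `y`. At a point of
  -- differentiability the two derivatives therefore coincide, whether or not the nearest point `p`
  -- is unique.
  let k : Plane → ℝ := fun z => 1 - c * ‖z - p‖
  have hn : HasFDerivAt (fun z : Plane => ‖z - p‖) (‖y - p‖⁻¹ • innerSL ℝ (y - p)) y := by
    have h2 : HasFDerivAt (fun z : Plane => ‖z - p‖ ^ 2) (2 • innerSL ℝ (y - p)) y := by
      have := ((hasFDerivAt_id (𝕜 := ℝ) y).sub_const p).norm_sq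
      simpa using this
    have h3 := h2.sqrt (by positivity)
    have h4 : (fun z : Plane => √(‖z - p‖ ^ 2)) = fun z => ‖z - p‖ := by
      funext z; exact Real.sqrt_sq (norm_nonneg _)
    rw [h4, Real.sqrt_sq hpos.le] at h3
    have h5 : ‖y - p‖⁻¹ • innerSL ℝ (y - p)
        = (1 / (2 * ‖y - p‖)) • (2 : ℕ) • innerSL ℝ (y - p) := by
      rw [← Nat.cast_smul_eq_nsmul ℝ, smul_smul]
      congr 1
      field_simp
      norm_num
    rw [h5]
    exact h3
  have hk : HasFDerivAt k (-((c : ℝ) • (‖y - p‖⁻¹ • innerSL ℝ (y - p)))) y :=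
    (hn.const_mul (c : ℝ)).const_sub 1
  have hloc : IsLocalMin (fun z => collar M c z - k z) y := by
    have hy : collar M c y = k y := by
      rw [collar, max_eq_right (by linarith), hyp, dist_eq_norm]
    refine Eventually.of_forall fun z => ?_
    have h5 : k z ≤ collar M c z := by
      refine le_trans ?_ (le_max_right _ _)
      have := infDist_le_dist_of_mem (x := z) hp
      rw [dist_eq_norm] at this
      have : (c : ℝ) * infDist z M ≤ c * ‖z - p‖ := by gcongr
      simp only [k]
      linarith
    simp only [hy, sub_self]
    linarith
  have heq := hloc.hasFDerivAt_eq_zero (hd.hasFDerivAt.sub hk)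
  rw [sub_eq_zero] at heq
  rw [heq]
  -- Tangency at `p` allows `W p` to be subtracted for free.
  have ht := hW p hp y hmin
  have h6 : inner ℝ (y - p) (W y) = inner ℝ (y - p) (W y - W p) := by
    rw [inner_sub_right, real_inner_comm (W p), ht, sub_zero]
  have h7 : ‖W y - W p‖ ≤ L * ‖y - p‖ := by
    simpa [dist_eq_norm] using hL.dist_le_mul y p
  have h8 : |inner ℝ (y - p) (W y)| ≤ ‖y - p‖ * (L * ‖y - p‖) := by
    rw [h6]
    exact (abs_real_inner_le_norm _ _).trans (by gcongr)
  have h9 : (c : ℝ) * ‖y - p‖ ≤ 1 := by rw [← dist_eq_norm, ← hyp]; exact h1.le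
  simp only [neg_apply, smul_apply, smul_eq_mul, abs_neg,
    abs_mul, innerSL_apply_apply, NNReal.abs_eq, abs_inv, abs_norm]
  calc (c : ℝ) * (‖y - p‖⁻¹ * |inner ℝ (y - p) (W y)|)
      ≤ c * (‖y - p‖⁻¹ * (‖y - p‖ * (L * ‖y - p‖))) := by gcongr
    _ = (c * ‖y - p‖) * L := by field_simp
    _ ≤ 1 * L := by gcongr
    _ = L := one_mul _

theorem hasCompactSupport_planeDiv {W : Plane → Plane} (hc : HasCompactSupport W) :
    HasCompactSupport (planeDiv W) := by
  refine (hc.fderiv (𝕜 := ℝ)).mono fun x hx => ?_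
  contrapose! hx
  simp only [Function.mem_support, not_not] at hx ⊢
  simp [planeDiv, hx]

theorem continuous_planeDiv {W : Plane → Plane} (hW : ContDiff ℝ 1 W) :
    Continuous (planeDiv W) := by
  have := hW.continuous_fderiv (by simp)
  unfold planeDiv
  fun_prop

/-- Integration by parts for Lipschitz functions, one coordinate at a time; Rademacher's theorem
then reassembles the line derivatives of the cutoff into `fderiv` almost everywhere. -/
theorem integral_collar_mul_planeDiv (M : Set Plane) (c : ℝ≥0) {W : Plane → Plane}
    (hW : ContDiff ℝ 1 W) (hc : HasCompactSupport W) :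
    ∫ x, collar M c x * planeDiv W x = - ∫ x, fderiv ℝ (collar M c) x (W x) := by
  have hf := lipschitzWith_collar M c
  obtain ⟨L, hL⟩ := hW.lipschitzWith_of_hasCompactSupport hc (by simp)
  let e : Fin 2 → Plane := fun i => EuclideanSpace.single i 1
  have hWi : ∀ i, LipschitzWith L fun x => W x i := fun i => by
    refine LipschitzWith.of_dist_le_mul fun x y => le_trans ?_ (hL.dist_le_mul x y)
    rw [dist_eq_norm, dist_eq_norm]
    exact PiLp.norm_apply_le (W x - W y) i
  have hci : ∀ i, HasCompactSupport fun x => W x i := fun i =>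
    hc.comp_left (g := fun w : Plane => w i) rfl
  -- The Lipschitz integration by parts moves the derivative to the other factor in the opposite
  -- direction, hence `-e i`.
  have hld : ∀ i x, lineDeriv ℝ (fun x => W x i) x (-e i) = - fderiv ℝ W x (e i) i := by
    intro i x
    have h1 : HasFDerivAt W (fderiv ℝ W x) x := (hW.differentiable (by simp) x).hasFDerivAt
    have h2 : HasFDerivAt (fun x => W x i)
        ((EuclideanSpace.proj i : Plane →L[ℝ] ℝ).comp (fderiv ℝ W x)) x :=
      (EuclideanSpace.proj i : Plane →L[ℝ] ℝ).hasFDerivAt.comp x h1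
    rw [(h2.hasLineDerivAt _).lineDeriv]
    simp
  have hI : ∀ i, Integrable (fun x => lineDeriv ℝ (collar M c) x (e i) * W x i) := fun i =>
    (hf.locallyIntegrable_lineDeriv (e i)).integrable_smul_right_of_hasCompactSupport
      (hWi i).continuous (hci i)
  have hI' : ∀ i, Integrable (fun x => fderiv ℝ W x (e i) i * collar M c x) := fun i => by
    have := hW.continuous_fderiv (by simp)
    have hcol := hf.continuous
    refine Continuous.integrable_of_hasCompactSupport (by fun_prop) ?_
    exact ((hc.fderiv (𝕜 := ℝ)).comp_left (g := fun A : Plane →L[ℝ] Plane => A (e i) i)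
      (by simp)).mul_right
  have hsum : ∑ i, ∫ x, lineDeriv ℝ (collar M c) x (e i) * W x i
      = ∑ i, - ∫ x, fderiv ℝ W x (e i) i * collar M c x := by
    refine Finset.sum_congr rfl fun i _ => ?_
    rw [hf.integral_lineDeriv_mul_eq (hWi i) (hci i), ← integral_neg]
    simp_rw [hld, neg_mul]
  rw [← integral_finsetSum _ fun i _ => hI i, Finset.sum_neg_distrib,
    ← integral_finsetSum _ fun i _ => hI' i] at hsum
  have hae : ∀ᵐ x, ∑ i, lineDeriv ℝ (collar M c) x (e i) * W x i
      = fderiv ℝ (collar M c) x (W x) := by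
    filter_upwards [hf.ae_differentiableAt] with x hx
    simp_rw [hx.lineDeriv_eq_fderiv]
    exact sum_apply_single_mul _ _
  rw [integral_congr_ae hae] at hsum
  rw [hsum, neg_neg]
  refine integral_congr_ae (Eventually.of_forall fun x => ?_)
  simp only [planeDiv, e, Finset.mul_sum, mul_comm]

/-- The divergence theorem for a compactly supported field tangent to a closed set. -/
theorem setIntegral_planeDiv_eq_zero {M : Set Plane} (hM : IsClosed M) {W : Plane → Plane}
    (hW : ContDiff ℝ 1 W) (hc : HasCompactSupport W) (ht : TangentTo M W) :
    ∫ x in M, planeDiv W x = 0 := by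
  rcases M.eq_empty_or_nonempty with rfl | hne
  · simp
  obtain ⟨L, hL⟩ := hW.lipschitzWith_of_hasCompactSupport hc (by simp)
  have hlarge : ∀ y, infDist y M ≠ 0 → ∀ᶠ n : ℕ in atTop, 1 ≤ ((n : ℝ≥0) : ℝ) * infDist y M := by
    intro y hy
    have hpos : 0 < infDist y M := lt_of_le_of_ne infDist_nonneg (Ne.symm hy)
    simpa using (tendsto_natCast_atTop_atTop.atTop_mul_const hpos).eventually_ge_atTop 1
  have hdiv := continuous_planeDiv hW
  have hdi : Integrable (planeDiv W) :=
    hdiv.integrable_of_hasCompactSupport (hasCompactSupport_planeDiv hc)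
  -- Closedness of `M` makes the cutoffs converge pointwise to the indicator of `M`.
  have h1 : Tendsto (fun n : ℕ => ∫ x, collar M n x * planeDiv W x) atTop
      (𝓝 (∫ x, M.indicator (planeDiv W) x)) := by
    refine tendsto_integral_of_dominated_convergence (fun x => ‖planeDiv W x‖) ?_ hdi.norm ?_ ?_
    · exact fun n =>
        ((lipschitzWith_collar M n).continuous.mul hdiv).aestronglyMeasurable
    · refine fun n => Eventually.of_forall fun x => ?_
      rw [norm_mul, Real.norm_of_nonneg (collar_nonneg M n x)]
      exact mul_le_of_le_one_left (norm_nonneg _) (collar_le_one M n x)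
    · refine Eventually.of_forall fun x => ?_
      by_cases hx : x ∈ M
      · simp only [collar_eq_one _ (infDist_zero_of_mem hx), one_mul, indicator_of_mem hx]
        exact tendsto_const_nhds
      · rw [indicator_of_notMem hx]
        refine tendsto_const_nhds.congr' ?_
        have hx' : infDist x M ≠ 0 := fun h => hx ((hM.mem_iff_infDist_zero hne).2 h)
        filter_upwards [hlarge x hx'] with n hn
        rw [collar_eq_zero hn, zero_mul]
  -- Each point leaves the collar for large `n`, and the uniform bound `L` on the compact support of
  -- `W` dominates.
  have h2 : Tendsto (fun n : ℕ => ∫ x, fderiv ℝ (collar M n) x (W x)) atTop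
      (𝓝 (∫ _ : Plane, (0 : ℝ))) := by
    refine tendsto_integral_of_dominated_convergence ((tsupport W).indicator fun _ => (L : ℝ))
      ?_ ?_ ?_ ?_
    · intro n
      have : Measurable fun x => fderiv ℝ (collar M n) x := measurable_fderiv ℝ _
      exact ((isBoundedBilinearMap_apply (𝕜 := ℝ) (E := Plane) (F := ℝ)).continuous.measurable.comp
        (this.prodMk hW.continuous.measurable)).aestronglyMeasurable
    · exact (integrable_indicator_iff (isClosed_tsupport W).measurableSet).2
        (integrableOn_const hc.isCompact.measure_lt_top.ne)
    · intro n
      filter_upwards [(lipschitzWith_collar M n).ae_differentiableAt] with x hx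
      by_cases hxs : x ∈ tsupport W
      · rw [indicator_of_mem hxs]
        exact abs_fderiv_collar_le hM hne hL ht hx
      · rw [indicator_of_notMem hxs, image_eq_zero_of_notMem_tsupport hxs]
        simp
    · refine Eventually.of_forall fun x => tendsto_const_nhds.congr' ?_
      by_cases hx : infDist x M = 0
      · exact Eventually.of_forall fun n => by simp [fderiv_collar_eq_zero (Or.inl hx)]
      · filter_upwards [hlarge x hx] with n hn
        simp [fderiv_collar_eq_zero (Or.inr hn)]
  simp_rw [integral_collar_mul_planeDiv M _ hW hc] at h1
  rw [integral_indicator hM.measurableSet] at h1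
  simpa using tendsto_nhds_unique h1 h2.neg

end Divergence

section Duality

/-! ### Extensions of fields and duality -/

theorem hasCompactSupport_of_bdd {F : Type*} [Zero F] {f : Plane → F} {R : ℝ}
    (h : ∀ x, R < ‖x‖ → f x = 0) : HasCompactSupport f :=
  HasCompactSupport.intro (isCompact_closedBall (0 : Plane) R) fun x hx =>
    h x (by simpa using hx)

theorem integrableOn_of_bdd {F : Type*} [NormedAddCommGroup F] {f : Plane → F} (hf : Continuous f) {R : ℝ}
    (h : ∀ x, R < ‖x‖ → f x = 0) (s : Set Plane) : IntegrableOn f s :=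
  (hf.integrable_of_hasCompactSupport (hasCompactSupport_of_bdd h)).integrableOn

theorem fderiv_eq_zero_of_bdd {F : Type*} [NormedAddCommGroup F] [NormedSpace ℝ F]
    {f : Plane → F} {R : ℝ} (h : ∀ x, R < ‖x‖ → f x = 0) {x : Plane} (hx : R < ‖x‖) :
    fderiv ℝ f x = 0 := by
  have : f =ᶠ[nhds x] fun _ => 0 := by
    filter_upwards [(isOpen_lt continuous_const continuous_norm).mem_nhds hx] with y hy
    exact h y hy
  rw [this.fderiv_eq]
  simp

section Extension

variable {M : Set Plane} {F : Type*} [NormedAddCommGroup F] [NormedSpace ℝ F]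

theorem exists_cutoff (R : ℝ) : ∃ χ : Plane → ℝ, ContDiff ℝ ∞ χ ∧ (∀ x, ‖x‖ ≤ R → χ x = 1) ∧
    ∃ R', ∀ x, R' < ‖x‖ → χ x = 0 := by
  let b : ContDiffBump (0 : Plane) := ⟨|R| + 1, |R| + 2, by positivity, by linarith⟩
  refine ⟨b, b.contDiff, fun x hx => b.one_of_mem_closedBall ?_, |R| + 2, fun x hx =>
    b.zero_of_le_dist ?_⟩
  · rw [mem_closedBall_zero_iff]
    exact hx.trans ((le_abs_self R).trans (by simp [b]))
  · rw [dist_zero_right]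
    exact hx.le

/-- A smooth family with bounded support on `M` extends to a smooth family with bounded support
on the plane. -/
theorem SmoothFamily.exists_extension_of_bddSupp {P : Type*} [NormedAddCommGroup P]
    [NormedSpace ℝ P] {f : P → M → F} (hf : SmoothFamily f) {R : ℝ}
    (hR : ∀ p (x : M), R < ‖(x : Plane)‖ → f p x = 0) :
    ∃ g : P × Plane → F, ContDiff ℝ ∞ g ∧ (∀ p (x : M), f p x = g (p, (x : Plane))) ∧
      ∃ R', ∀ p x, R' < ‖x‖ → g (p, x) = 0 := by
  obtain ⟨g, hg, e⟩ := hf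
  obtain ⟨χ, hχ, h1, R', h0⟩ := exists_cutoff R
  refine ⟨fun p => χ p.2 • g p, (hχ.comp contDiff_snd).smul hg, fun p x => ?_, R', fun p x hx => ?_⟩
  · rcases le_or_gt ‖(x : Plane)‖ R with h | h
    · simp [h1 _ h, e]
    -- Beyond radius `R` the cutoff is not controlled, but on `M` the extension itself already
    -- vanishes there.
    · have := e p x
      rw [hR p x h] at this
      simp [← this, hR p x h]
  · simp [h0 x hx]

theorem Smooth.exists_extension (a : Smooth M F) :
    ∃ g : Plane → F, ContDiff ℝ ∞ g ∧ ∀ x : M, val a x = g x := a.2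

theorem Vec.exists_extension (u : Vec M) :
    ∃ g : Plane → Plane, ContDiff ℝ ∞ g ∧ ∀ x : M, vval u x = g x := (u : Smooth M Plane).2

theorem BddSupp.exists_extension {v : Vec M} (h : BddSupp v) :
    ∃ g : Plane → Plane, ContDiff ℝ ∞ g ∧ (∀ x : M, vval v x = g x) ∧
      ∃ R, ∀ x, R < ‖x‖ → g x = 0 := by
  obtain ⟨R, hR⟩ := h
  obtain ⟨g, hg, e⟩ := Vec.exists_extension v
  have hf : SmoothFamily (P := ℝ) (fun _ => vval v) := ⟨fun p => g p.2, by fun_prop, fun _ => e⟩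
  obtain ⟨k, hk, e', R', h0⟩ := hf.exists_extension_of_bddSupp (fun _ => hR)
  exact ⟨fun x => k (0, x), hk.comp (by fun_prop), e' 0, R', h0 0⟩

/-- Tangency only tests values at points of `M`, so every extension inherits it. -/
theorem tangentTo_of_eq {u : Vec M} {U : Plane → Plane} (h : ∀ x : M, vval u x = U x) :
    TangentTo M U := by
  intro p hp y hy
  rw [← h ⟨p, hp⟩]
  exact u.2 ⟨p, hp⟩ y hy

theorem TangentTo.smul {U : Plane → Plane} (h : TangentTo M U) (k : Plane → ℝ) :
    TangentTo M fun x => k x • U x := by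
  intro p hp y hy
  simp [inner_smul_left, h p hp y hy]

theorem dv_eq (hM : M ⊆ closure (interior M)) {u : Vec M} {U : Plane → Plane}
    (hU : ContDiff ℝ ∞ U) (h : ∀ x : M, vval u x = U x) (x : M) : dv u x = fderiv ℝ U x :=
  d_eq hM _ U hU h x

theorem div_eq (hM : M ⊆ closure (interior M)) {u : Vec M} {U : Plane → Plane}
    (hU : ContDiff ℝ ∞ U) (h : ∀ x : M, vval u x = U x) (x : M) : div u x = planeDiv U x := by
  simp only [div, planeDiv, dv_eq hM hU h]

theorem integral_area_eq (hM : IsClosed M) {f : M → ℝ} {g : Plane → ℝ} (h : ∀ x : M, f x = g x) :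
    ∫ x, f x ∂(area M) = ∫ x in M, g x := by
  simp_rw [h]
  exact integral_subtype_comap hM.measurableSet g

end Extension

/-! ### Duality by integration by parts -/

theorem planeDiv_smul {k : Plane → ℝ} {U : Plane → Plane} {x : Plane}
    (hk : DifferentiableAt ℝ k x) (hU : DifferentiableAt ℝ U x) :
    planeDiv (fun y => k y • U y) x = fderiv ℝ k x (U x) + k x * planeDiv U x := by
  simp only [planeDiv]
  rw [fderiv_fun_smul hk hU]
  simp [← sum_apply_single_mul (fderiv ℝ k x) (U x)]
  ring

/-- The divergence theorem for `k U`, where `U` is tangent to `M`. -/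
theorem setIntegral_div_smul_eq_zero {M : Set Plane} (hM : IsClosed M) {k : Plane → ℝ}
    {U : Plane → Plane} (hk : ContDiff ℝ ∞ k) (hU : ContDiff ℝ ∞ U) (ht : TangentTo M U) {R : ℝ}
    (h : ∀ x, R < ‖x‖ → k x • U x = 0) :
    ∫ x in M, (fderiv ℝ k x (U x) + k x * planeDiv U x) = 0 := by
  rw [← setIntegral_planeDiv_eq_zero hM ((hk.smul hU).of_le (by simp))
    (hasCompactSupport_of_bdd h) (ht.smul k)]
  refine integral_congr_ae (Filter.Eventually.of_forall fun x => ?_)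
  exact (planeDiv_smul (hk.differentiable (by simp) x) (hU.differentiable (by simp) x)).symm

variable {M : Set Plane}

/-- The two integrands differ by the divergence of `m(v) u`, a field tangent to `M` because `u` is,
and of bounded support because `v` is. -/
theorem pairVec_adStar (hM : IsClosed M) (hM' : M ⊆ closure (interior M)) (u v : Vec M)
    (m : OneFormDen M) (hv : BddSupp v) :
    pairVec (adStar u m) (vval v) = pairVec (val m) (adVec u v) := by
  obtain ⟨U, hU, eU⟩ := Vec.exists_extension u
  obtain ⟨V, hV, eV, R, hR⟩ := hv.exists_extension
  obtain ⟨m', hm, em⟩ := Smooth.exists_extension m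
  have hfU := hU.continuous_fderiv (by simp)
  have hfV := hV.continuous_fderiv (by simp)
  have hfm := hm.continuous_fderiv (by simp)
  have hU0 := hU.continuous
  have hV0 := hV.continuous
  have hm0 := hm.continuous
  have hdU := continuous_planeDiv (hU.of_le (by simp))
  have hfR : ∀ x, R < ‖x‖ → fderiv ℝ V x = 0 := fun x hx => fderiv_eq_zero_of_bdd hR hx
  have h := setIntegral_div_smul_eq_zero hM (k := fun x => m' x (V x)) (hm.clm_apply hV) hU
    (tangentTo_of_eq eU) (R := R) (fun x hx => by simp [hR x hx])
  rw [pairVec, pairVec,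
    integral_area_eq hM (g := fun x => (fderiv ℝ m' x (U x)) (V x) + m' x (fderiv ℝ U x (V x)) +
      planeDiv U x * m' x (V x)),
    integral_area_eq hM (g := fun x => - m' x (fderiv ℝ V x (U x) - fderiv ℝ U x (V x))),
    ← sub_eq_zero, ← integral_sub, ← h]
  · refine integral_congr_ae (Filter.Eventually.of_forall fun x => ?_)
    simp only
    rw [fderiv_clm_apply (hm.differentiable (by simp) x) (hV.differentiable (by simp) x)]
    simp
    ring
  · exact integrableOn_of_bdd (by fun_prop) (R := R) (fun x hx => by simp [hR x hx]) M
  · exact integrableOn_of_bdd (by fun_prop) (R := R) (fun x hx => by simp [hR x hx, hfR x hx]) M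
  · intro x
    simp [adVec, bracket, dv_eq hM' hU eU, dv_eq hM' hV eV, eU, eV, em]
  · intro x
    simp [adStar, dv_eq hM' hU eU, div_eq hM' hU eU, d_eq hM' m m' hm em, eU, eV, em]

theorem pairVec_diamondFun (v : Vec M) (b : Den M) (a : Fun M) :
    - pairVec (diamondFun b a) (vval v) = pairFun (lieFun v a) (val b) := by
  simp only [pairVec, pairFun, diamondFun, lieFun, ← integral_neg]
  congr 1
  funext x
  simp [mul_comm]

/-- The integrands `D ∇b · v` and `b div (D v)` add up to the divergence of `b D v`, which is
tangent because `v` is. -/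
theorem pairVec_diamondDen (hM : IsClosed M) (hM' : M ⊆ closure (interior M)) (v : Vec M)
    (b : Fun M) (D : Den M) (hv : BddSupp v) :
    - pairVec (diamondDen b D) (vval v) = pairFun (lieDen v D) (val b) := by
  obtain ⟨V, hV, eV, R, hR⟩ := hv.exists_extension
  obtain ⟨b', hb, eb⟩ := Smooth.exists_extension b
  obtain ⟨D', hD, eD⟩ := Smooth.exists_extension D
  have hfb := hb.continuous_fderiv (by simp)
  have hfD := hD.continuous_fderiv (by simp)
  have hV0 := hV.continuous
  have hb0 := hb.continuous
  have hD0 := hD.continuous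
  have hdV := continuous_planeDiv (hV.of_le (by simp))
  have hdR : ∀ x, R < ‖x‖ → planeDiv V x = 0 := fun x hx => by
    simp [planeDiv, fderiv_eq_zero_of_bdd hR hx]
  have h := setIntegral_div_smul_eq_zero hM (hb.mul hD) hV
    (tangentTo_of_eq eV) (R := R) (fun x hx => by simp [hR x hx])
  rw [pairVec, pairFun,
    integral_area_eq hM (g := fun x => D' x * fderiv ℝ b' x (V x)),
    integral_area_eq hM (g := fun x => (fderiv ℝ D' x (V x) + D' x * planeDiv V x) * b' x),
    eq_comm, ← sub_eq_zero, sub_neg_eq_add, ← integral_add, ← h]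
  · refine integral_congr_ae (Filter.Eventually.of_forall fun x => ?_)
    simp only
    rw [fderiv_fun_mul (hb.differentiable (by simp) x) (hD.differentiable (by simp) x)]
    simp
    ring
  · exact integrableOn_of_bdd (by fun_prop) (R := R) (fun x hx => by simp [hR x hx, hdR x hx]) M
  · exact integrableOn_of_bdd (by fun_prop) (R := R) (fun x hx => by simp [hR x hx]) M
  · intro x
    simp [lieDen, div_eq hM' hV eV, d_eq hM' D D' hD eD, eV, eD, eb]
  · intro x
    simp [diamondDen, d_eq hM' b b' hb eb, eV, eD]

end Duality

section Diffeomorphisms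

/-! ### Families of diffeomorphisms and their velocity fields -/

/-! ### Partial derivatives in the parameter and in the point -/

section PartialDeriv

variable {P F : Type*} [NormedAddCommGroup P] [NormedSpace ℝ P] [NormedAddCommGroup F]
  [NormedSpace ℝ F]

theorem fderiv_slice {f : P × Plane → F} (hf : ContDiff ℝ ∞ f) (p : P) (y : Plane) :
    fderiv ℝ (fun y => f (p, y)) y = (fderiv ℝ f (p, y)).comp (.inr ℝ P Plane) :=
  ((hf.differentiable (by simp) (p, y)).hasFDerivAt.comp y
    (hasFDerivAt_prodMk_right p y)).fderiv

theorem hasDerivAt_slice {f : P × Plane → F} (hf : ContDiff ℝ ∞ f) {c : ℝ → P} {c' : P} {t : ℝ}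
    (hc : HasDerivAt c c' t) (y : Plane) :
    HasDerivAt (fun τ => f (c τ, y)) (fderiv ℝ f (c t, y) (c', 0)) t :=
  (hf.differentiable (by simp) (c t, y)).hasFDerivAt.comp_hasDerivAt t
    (hc.prodMk (hasDerivAt_const t y))

theorem hasDerivAt_line (p a : P) : HasDerivAt (fun τ : ℝ => p + τ • a) a 0 := by
  simpa using ((hasDerivAt_id (0 : ℝ)).smul_const a).const_add p

/-- A parameter derivative only sees the fixed point `x`. Identities between extensions that hold
only for `x ∈ M` can thus be differentiated in the parameter. -/
theorem fderiv_param_eq_of_eq {f k : P × Plane → F} (hf : ContDiff ℝ ∞ f) (hk : ContDiff ℝ ∞ k)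
    {x : Plane} (he : ∀ p, f (p, x) = k (p, x)) (p a : P) :
    fderiv ℝ f (p, x) (a, 0) = fderiv ℝ k (p, x) (a, 0) := by
  have hc := hasDerivAt_line p a
  have h1 := hasDerivAt_slice hf hc x
  have h2 := hasDerivAt_slice hk hc x
  simp only [he, zero_smul, add_zero] at h1 h2
  exact h1.unique h2

/-- The spatial counterpart: density of the interior allows identities that hold only on `M` to be
differentiated in space, boundary points included. -/
theorem fderiv_eq_of_eqOn {M : Set Plane} (hM : M ⊆ closure (interior M)) {f g : Plane → F}
    (hf : ContDiff ℝ ∞ f) (hg : ContDiff ℝ ∞ g) (h : EqOn f g M) {x : Plane} (hx : x ∈ M) :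
    fderiv ℝ f x = fderiv ℝ g x := by
  let a : Smooth M F := ⟨fun x => f x, f, hf, fun _ => rfl⟩
  rw [← d_eq hM a f hf (fun _ => rfl) ⟨x, hx⟩, ← d_eq hM a g hg (fun y => h y.2) ⟨x, hx⟩]

theorem fderiv_apply_fderiv_comm {E : Type*} [NormedAddCommGroup E] [NormedSpace ℝ E] {f : E → F}
    (hf : ContDiff ℝ ∞ f) (z a b : E) :
    fderiv ℝ (fun w => fderiv ℝ f w a) z b = fderiv ℝ (fun w => fderiv ℝ f w b) z a := by
  have hd : DifferentiableAt ℝ (fderiv ℝ f) z :=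
    (hf.fderiv_right (m := ∞) (by simp)).differentiable (by simp) z
  have h : ∀ c, fderiv ℝ (fun w => fderiv ℝ f w c) z = (fderiv ℝ (fderiv ℝ f) z).flip c := by
    intro c
    rw [fderiv_clm_apply hd (differentiableAt_const c)]
    simp
  rw [h, h]
  exact (hf.contDiffAt.isSymmSndFDerivAt (by
    simpa using WithTop.coe_le_coe.2 (le_top : (2 : ℕ∞) ≤ ⊤))).eq b a

theorem contDiff_fderiv_apply {E : Type*} [NormedAddCommGroup E] [NormedSpace ℝ E] {f : E → F}
    (hf : ContDiff ℝ ∞ f) (a : E) : ContDiff ℝ ∞ fun w => fderiv ℝ f w a :=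
  (hf.fderiv_right (m := ∞) (by simp)).clm_apply contDiff_const

end PartialDeriv

/-! ### Determinants on the plane and velocities of curves in `M` -/

theorem det_plane (A : Plane →L[ℝ] Plane) :
    A.det = A (EuclideanSpace.single 0 1) 0 * A (EuclideanSpace.single 1 1) 1 -
      A (EuclideanSpace.single 1 1) 0 * A (EuclideanSpace.single 0 1) 1 := by
  rw [ContinuousLinearMap.det,
    ← LinearMap.det_toMatrix (EuclideanSpace.basisFun (Fin 2) ℝ).toBasis, Matrix.det_fin_two]
  simp [LinearMap.toMatrix_apply]

theorem plane_eq_sum (w : Plane) :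
    w = w 0 • EuclideanSpace.single 0 (1 : ℝ) + w 1 • EuclideanSpace.single 1 (1 : ℝ) := by
  ext j
  fin_cases j <;> simp

/-- The Jacobi formula for the determinant of a solution of `dA/dt = B A`. -/
theorem hasDerivAt_det_plane {A : ℝ → Plane →L[ℝ] Plane} {B : Plane →L[ℝ] Plane} {t : ℝ}
    (h : HasDerivAt A (B.comp (A t)) t) :
    HasDerivAt (fun τ => (A τ).det)
      ((∑ i : Fin 2, B (EuclideanSpace.single i 1) i) * (A t).det) t := by
  have hij : ∀ i j : Fin 2, HasDerivAt (fun τ => A τ (EuclideanSpace.single i 1) j)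
      (B (A t (EuclideanSpace.single i 1)) j) t := fun i j => by
    have h1 := h.clm_apply (hasDerivAt_const t (EuclideanSpace.single i (1 : ℝ) : Plane))
    have h2 := (EuclideanSpace.proj j : Plane →L[ℝ] ℝ).hasFDerivAt.comp_hasDerivAt t h1
    exact h2.congr_deriv (by simp)
  simp_rw [det_plane]
  have h3 := ((hij 0 0).mul (hij 1 1)).sub ((hij 1 0).mul (hij 0 1))
  refine h3.congr_deriv ?_
  have hB : ∀ (w : Plane) (j : Fin 2), B w j = w 0 * B (EuclideanSpace.single 0 1) j
      + w 1 * B (EuclideanSpace.single 1 1) j := fun w j => by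
    conv_lhs => rw [plane_eq_sum w]
    simp
  rw [hB (A t (EuclideanSpace.single 0 1)), hB (A t (EuclideanSpace.single 0 1)),
    hB (A t (EuclideanSpace.single 1 1)), hB (A t (EuclideanSpace.single 1 1))]
  simp only [Fin.sum_univ_two]
  ring

theorem contDiff_det_plane {E : Type*} [NormedAddCommGroup E] [NormedSpace ℝ E]
    {A : E → Plane →L[ℝ] Plane} (hA : ContDiff ℝ ∞ A) : ContDiff ℝ ∞ fun z => (A z).det := by
  simp_rw [det_plane]
  have h : ∀ i j : Fin 2, ContDiff ℝ ∞ fun z => A z (EuclideanSpace.single i 1) j := fun i j =>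
    (EuclideanSpace.proj j : Plane →L[ℝ] ℝ).contDiff.comp (hA.clm_apply contDiff_const)
  exact ((h 0 0).mul (h 1 1)).sub ((h 1 0).mul (h 0 1))

/-- The velocity of a curve in `M` is tangent to `M`. -/
theorem inner_velocity_eq_zero {M : Set Plane} {γ : ℝ → Plane} {γ' : Plane} {t : ℝ}
    (hγ : HasDerivAt γ γ' t) (hM : ∀ᶠ τ in nhds t, γ τ ∈ M) {y : Plane}
    (hy : ∀ z ∈ M, dist y (γ t) ≤ dist y z) : inner ℝ γ' (y - γ t) = 0 := by
  have h1 := (hγ.const_sub y).norm_sq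
  -- The curve stays in `M` and passes at time `t` through a point of `M` nearest to `y`, so its
  -- squared distance to `y` is minimal there.
  have h2 : IsLocalMin (fun τ => ‖y - γ τ‖ ^ 2) t := by
    filter_upwards [hM] with τ hτ
    have := hy (γ τ) hτ
    simp only [dist_eq_norm] at this
    exact pow_le_pow_left₀ (norm_nonneg _) this 2
  have h3 := h2.hasDerivAt_eq_zero h1
  rw [real_inner_comm]
  simpa using h3

/-- `Φ` and `G` extend a smooth family of diffeomorphisms of `M` and the family of inverses. -/
structure IsDiffeoExtension (M : Set Plane) {P : Type*} [NormedAddCommGroup P] [NormedSpace ℝ P]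
    (Φ G : P × Plane → Plane) : Prop where
  contDiff : ContDiff ℝ ∞ Φ
  contDiff_inv : ContDiff ℝ ∞ G
  mem : ∀ p, ∀ x ∈ M, Φ (p, x) ∈ M
  inv_mem : ∀ p, ∀ x ∈ M, G (p, x) ∈ M
  left_inv : ∀ p, ∀ x ∈ M, G (p, Φ (p, x)) = x
  right_inv : ∀ p, ∀ x ∈ M, Φ (p, G (p, x)) = x

/-- The push-forward by the diffeomorphism with inverse `G` of the derivative of `k` with respect
to the parameter in the direction `a`. -/
def pushDeriv {P F : Type*} [NormedAddCommGroup P] [NormedSpace ℝ P] [NormedAddCommGroup F]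
    [NormedSpace ℝ F] (G : P × Plane → Plane) (k : P × Plane → F) (a : P) (z : P × Plane) : F :=
  fderiv ℝ k (z.1, G z) (a, 0)

namespace IsDiffeoExtension

variable {M : Set Plane} {P F : Type*} [NormedAddCommGroup P] [NormedSpace ℝ P]
  [NormedAddCommGroup F] [NormedSpace ℝ F] {Φ G : P × Plane → Plane}

theorem contDiff_pushDeriv (h : IsDiffeoExtension M Φ G) {k : P × Plane → F}
    (hk : ContDiff ℝ ∞ k) (a : P) : ContDiff ℝ ∞ (pushDeriv G k a) :=
  (contDiff_fderiv_apply hk (a, 0)).comp (contDiff_fst.prodMk h.contDiff_inv)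

theorem pushDeriv_apply (h : IsDiffeoExtension M Φ G) (k : P × Plane → F) (a : P) (p : P)
    {x : Plane} (hx : x ∈ M) :
    pushDeriv G k a (p, Φ (p, x)) = fderiv ℝ k (p, x) (a, 0) := by
  simp only [pushDeriv, h.left_inv p x hx]

/-- The derivative of a family of fields along the flow lines. -/
theorem fderiv_comp_apply (h : IsDiffeoExtension M Φ G) {f : P × Plane → F} (hf : ContDiff ℝ ∞ f)
    (p a : P) {x : Plane} (hx : x ∈ M) :
    fderiv ℝ (fun z : P × Plane => f (z.1, Φ z)) (p, x) (a, 0) =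
      fderiv ℝ f (p, Φ (p, x)) (a, 0) +
        fderiv ℝ f (p, Φ (p, x)) (0, pushDeriv G Φ a (p, Φ (p, x))) := by
  have h1 : HasFDerivAt (fun z : P × Plane => (z.1, Φ z))
      ((ContinuousLinearMap.fst ℝ P Plane).prod (fderiv ℝ Φ (p, x))) (p, x) :=
    hasFDerivAt_fst.prodMk (h.contDiff.differentiable (by simp) (p, x)).hasFDerivAt
  have h2 := (hf.differentiable (by simp) (p, Φ (p, x))).hasFDerivAt.comp (p, x) h1
  have h3 : fderiv ℝ (fun z : P × Plane => f (z.1, Φ z)) (p, x) = _ := h2.fderiv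
  rw [h3, ← map_add, h.pushDeriv_apply Φ a p hx]
  simp

/-- Compatibility of the push-forwards of two parameter derivatives. -/
theorem fderiv_pushDeriv_comm (h : IsDiffeoExtension M Φ G) {k : P × Plane → F}
    (hk : ContDiff ℝ ∞ k) (a b p : P) {y : Plane} (hy : y ∈ M) :
    fderiv ℝ (pushDeriv G k b) (p, y) (a, 0) +
        fderiv ℝ (pushDeriv G k b) (p, y) (0, pushDeriv G Φ a (p, y)) =
      fderiv ℝ (pushDeriv G k a) (p, y) (b, 0) +
        fderiv ℝ (pushDeriv G k a) (p, y) (0, pushDeriv G Φ b (p, y)) := by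
  have hx := h.inv_mem p y hy
  -- Along the trajectory with label `G (p, y)`, `pushDeriv G k b` is the parameter derivative of
  -- `k` at that label. Each side is thus a mixed second derivative of `k`.
  have key : ∀ a b : P, fderiv ℝ (pushDeriv G k b) (p, y) (a, 0) +
      fderiv ℝ (pushDeriv G k b) (p, y) (0, pushDeriv G Φ a (p, y)) =
      fderiv ℝ (fun w => fderiv ℝ k w (b, 0)) (p, G (p, y)) (a, 0) := by
    intro a b
    have h1 := h.fderiv_comp_apply (h.contDiff_pushDeriv hk b) p a hx
    rw [h.right_inv p y hy] at h1
    rw [← h1]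
    exact fderiv_param_eq_of_eq
      ((h.contDiff_pushDeriv hk b).comp (contDiff_fst.prodMk h.contDiff))
      (contDiff_fderiv_apply hk _) (fun q => h.pushDeriv_apply k b q hx) p a
  rw [key, key, fderiv_apply_fderiv_comm hk]

/-- The spatial derivative of the diffeomorphisms. -/
theorem fderiv_inv_comp (hM : M ⊆ closure (interior M)) (h : IsDiffeoExtension M Φ G) (p : P)
    {x : Plane} (hx : x ∈ M) :
    (fderiv ℝ (fun y => G (p, y)) (Φ (p, x))).comp (fderiv ℝ (fun y => Φ (p, y)) x) =
      ContinuousLinearMap.id ℝ Plane := by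
  have hΦ : ContDiff ℝ ∞ fun y => Φ (p, y) := h.contDiff.comp (contDiff_prodMk_right p)
  have hG : ContDiff ℝ ∞ fun y => G (p, y) := h.contDiff_inv.comp (contDiff_prodMk_right p)
  have h1 := fderiv_eq_of_eqOn hM (hG.comp hΦ) contDiff_id (fun y hy => h.left_inv p y hy) hx
  rw [fderiv_comp x (hG.differentiable (by simp) _) (hΦ.differentiable (by simp) _)] at h1
  rw [h1]
  exact fderiv_id

/-- Serves twice: the Jacobian of the inverse is the factor that pushes densities forward, and the
Jacobian of the diffeomorphism is nonzero on `M`. -/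
theorem det_inv_mul_det (hM : M ⊆ closure (interior M)) (h : IsDiffeoExtension M Φ G) (p : P)
    {x : Plane} (hx : x ∈ M) :
    (fderiv ℝ (fun y => G (p, y)) (Φ (p, x))).det * (fderiv ℝ (fun y => Φ (p, y)) x).det = 1 := by
  have h1 := congrArg ContinuousLinearMap.det (h.fderiv_inv_comp hM p hx)
  simpa [ContinuousLinearMap.det] using h1

/-- The Jacobian determinant evolves by the divergence of the velocity. -/
theorem hasDerivAt_det (hM : M ⊆ closure (interior M)) (h : IsDiffeoExtension M Φ G)
    {c : ℝ → P} {a : P} {t : ℝ} (hc : HasDerivAt c a t) {x : Plane} (hx : x ∈ M) :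
    HasDerivAt (fun τ => (fderiv ℝ (fun y => Φ (c τ, y)) x).det)
      (planeDiv (fun y => pushDeriv G Φ a (c t, y)) (Φ (c t, x)) *
        (fderiv ℝ (fun y => Φ (c t, y)) x).det) t := by
  apply hasDerivAt_det_plane
  have hΦ : ContDiff ℝ ∞ fun y => Φ (c t, y) := h.contDiff.comp (contDiff_prodMk_right _)
  have hX : ContDiff ℝ ∞ fun y => pushDeriv G Φ a (c t, y) :=
    (h.contDiff_pushDeriv h.contDiff a).comp (contDiff_prodMk_right _)
  have hfd : ContDiff ℝ ∞ (fderiv ℝ Φ) := h.contDiff.fderiv_right (by simp)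
  have h1 : HasDerivAt (fun τ => fderiv ℝ (fun y => Φ (c τ, y)) x)
      ((fderiv ℝ (fderiv ℝ Φ) (c t, x) (a, 0)).comp (.inr ℝ P Plane)) t := by
    simp_rw [fderiv_slice h.contDiff]
    exact (hasDerivAt_slice hfd hc x).clm_comp (hasDerivAt_const t _) |>.congr_deriv (by simp)
  refine h1.congr_deriv ?_
  -- The flow equation `∂_a Φ = X ∘ Φ`, with `X` the velocity field, holds on `M` and may be
  -- differentiated in space. Exchanging the two derivatives gives the equation `A' = (DX) A`
  -- required by Jacobi's formula.
  have h2 := fderiv_eq_of_eqOn hM (hX.comp hΦ)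
    ((contDiff_fderiv_apply h.contDiff (a, 0)).comp (contDiff_prodMk_right (c t)))
    (fun y hy => h.pushDeriv_apply Φ a (c t) hy) hx
  rw [fderiv_comp x (hX.differentiable (by simp) _) (hΦ.differentiable (by simp) _)] at h2
  rw [h2]
  have h3 := fderiv_slice (contDiff_fderiv_apply h.contDiff (a, 0)) (c t) x
  refine Eq.trans ?_ h3.symm
  ext w : 1
  have h4 := fderiv_apply_fderiv_comm h.contDiff (c t, x) (a, 0) (0, w)
  simp only [ContinuousLinearMap.comp_apply, ContinuousLinearMap.inr_apply]
  rw [h4]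
  have hd : DifferentiableAt ℝ (fderiv ℝ Φ) (c t, x) := hfd.differentiable (by simp) _
  rw [fderiv_clm_apply hd (differentiableAt_const _)]
  simp

end IsDiffeoExtension

end Diffeomorphisms

section ConstrainedVariations

/-! ### Constrained variations -/

namespace IsDiffeoExtension

variable {M : Set Plane} {P : Type*} [NormedAddCommGroup P] [NormedSpace ℝ P]
  {Φ G : P × Plane → Plane}

/-- The trajectory of a label in `M` never leaves `M`, so its velocity is orthogonal to the proximal
normals. This puts both `u_S` and `v_S` in `𝔛(M)`. -/
theorem tangentTo_pushDeriv (h : IsDiffeoExtension M Φ G) (a p : P) :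
    TangentTo M fun y => pushDeriv G Φ a (p, y) := by
  intro y hy w hw
  have hx := h.inv_mem p y hy
  have h1 := hasDerivAt_slice h.contDiff (hasDerivAt_line p a) (G (p, y))
  simp only [zero_smul, add_zero] at h1
  have h2 := inner_velocity_eq_zero (y := w) h1 (.of_forall fun τ => h.mem _ _ hx)
  simp only [zero_smul, add_zero, h.right_inv p y hy] at h2
  exact h2 hw

/-- The continuity equation for a density that is carried along by the diffeomorphisms. -/
theorem continuity_equation (hM : M ⊆ closure (interior M)) (h : IsDiffeoExtension M Φ G)
    {f : P × Plane → ℝ} (hf : ContDiff ℝ ∞ f) {r : Plane → ℝ}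
    (hr : ∀ p, ∀ x ∈ M, f (p, Φ (p, x)) * (fderiv ℝ (fun y => Φ (p, y)) x).det = r x) (p a : P)
    {y : Plane} (hy : y ∈ M) :
    fderiv ℝ f (p, y) (a, 0) + fderiv ℝ f (p, y) (0, pushDeriv G Φ a (p, y)) +
      f (p, y) * planeDiv (fun y => pushDeriv G Φ a (p, y)) y = 0 := by
  have hx := h.inv_mem p y hy
  have h1 := hasDerivAt_slice (f := fun z : P × Plane => f (z.1, Φ z))
    (hf.comp (contDiff_fst.prodMk h.contDiff)) (hasDerivAt_line p a) (G (p, y))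
  have h2 := h.hasDerivAt_det hM (hasDerivAt_line p a) hx
  have h3 := h1.mul h2
  -- Density times Jacobian is constant along each trajectory; its derivative is the continuity
  -- equation times the Jacobian, which is cancelled at the end.
  have h4 : ((fun τ : ℝ => f (p + τ • a, Φ (p + τ • a, G (p, y)))) * fun τ : ℝ =>
      (fderiv ℝ (fun y => Φ (p + τ • a, y)) (G (p, y))).det) = fun _ => r (G (p, y)) :=
    funext fun τ => hr _ _ hx
  rw [h4] at h3
  have h5 := h3.unique (hasDerivAt_const 0 _)
  have h6 := h.fderiv_comp_apply hf p a hx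
  have h7 := h.det_inv_mul_det hM p hx
  simp only [zero_smul, add_zero, h.right_inv p y hy] at h5 h6 h7
  rw [h6] at h5
  refine (mul_eq_zero.1 (?_ : _ * (fderiv ℝ (fun y => Φ (p, y)) (G (p, y))).det = 0)).resolve_right
    (right_ne_zero_of_mul_eq_one h7)
  linear_combination h5

end IsDiffeoExtension

/-! ### Restriction of fields from the plane to `M` -/

section OfFun

variable {M : Set Plane} {F : Type*} [NormedAddCommGroup F] [NormedSpace ℝ F]

/-- The restriction to `M` of a smooth map on the plane. -/
def Smooth.ofFun (M : Set Plane) {f : Plane → F} (hf : ContDiff ℝ ∞ f) : Smooth M F :=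
  ⟨fun x => f x, f, hf, fun _ => rfl⟩

/-- The restriction to `M` of a smooth vector field on the plane that is tangent to `M`. -/
def Vec.ofFun {f : Plane → Plane} (hf : ContDiff ℝ ∞ f) (ht : TangentTo M f) : Vec M :=
  ⟨Smooth.ofFun M hf, fun p y hy => ht p p.2 y hy⟩

theorem val_ofFun {f : Plane → F} (hf : ContDiff ℝ ∞ f) (x : M) :
    val (Smooth.ofFun M hf) x = f x := rfl

theorem vval_ofFun {f : Plane → Plane} (hf : ContDiff ℝ ∞ f) (ht : TangentTo M f) (x : M) :
    vval (Vec.ofFun hf ht) x = f x := rfl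

theorem d_ofFun (hM : M ⊆ closure (interior M)) {f : Plane → F} (hf : ContDiff ℝ ∞ f) (x : M) :
    d (Smooth.ofFun M hf) x = fderiv ℝ f x := d_eq hM _ f hf (fun _ => rfl) x

theorem dv_ofFun (hM : M ⊆ closure (interior M)) {f : Plane → Plane} (hf : ContDiff ℝ ∞ f)
    (ht : TangentTo M f) (x : M) :
    dv (Vec.ofFun hf ht) x = fderiv ℝ f x := dv_eq hM hf (fun _ => rfl) x

theorem div_ofFun (hM : M ⊆ closure (interior M)) {f : Plane → Plane} (hf : ContDiff ℝ ∞ f)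
    (ht : TangentTo M f) (x : M) :
    div (Vec.ofFun hf ht) x = planeDiv f x := div_eq hM hf (fun _ => rfl) x

end OfFun

variable {M : Set Plane}

theorem Variation.ext' {w w' : Variation M} (h1 : ∀ x, w.uS x = w'.uS x)
    (h2 : ∀ x, w.uT x = w'.uT x) (h3 : ∀ x, w.D x = w'.D x) (h4 : ∀ x, w.θ x = w'.θ x) :
    w = w' := by
  cases w
  cases w'
  simp only [Variation.mk.injEq]
  exact ⟨funext h1, funext h2, funext h3, funext h4⟩

theorem exists_isDiffeoExtension {P : Type*} [NormedAddCommGroup P] [NormedSpace ℝ P]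
    {g : P → SliceGroup M} (hg : SmoothGroupFamily g) :
    ∃ (Φ G : P × Plane → Plane), IsDiffeoExtension M Φ G ∧
      (∀ p (x : M), ((g p).φ x : Plane) = Φ (p, (x : Plane))) ∧
      ∀ p (x : M), ((g p).φ.symm x : Plane) = G (p, (x : Plane)) := by
  obtain ⟨⟨Φ, hΦ, eΦ⟩, ⟨G, hG, eG⟩, -⟩ := hg
  refine ⟨Φ, G, ⟨hΦ, hG, ?_, ?_, ?_, ?_⟩, eΦ, eG⟩
  · intro p x hx
    rw [← eΦ p ⟨x, hx⟩]
    exact Subtype.coe_prop _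
  · intro p x hx
    rw [← eG p ⟨x, hx⟩]
    exact Subtype.coe_prop _
  · intro p x hx
    rw [← eΦ p ⟨x, hx⟩, ← eG]
    simp
  · intro p x hx
    rw [← eG p ⟨x, hx⟩, ← eΦ]
    simp

/-- Explicit formulas in terms of `Φ`, `G` and the extension `N` of `v` define all fields on the
plane, which makes smoothness immediate. The variation formulas are then checked on `M`, where the
inverse relations hold. -/
theorem exists_constrainedVariation (hM : M ⊆ closure (interior M)) (s : ℝ)
    (g : ℝ × ℝ → SliceGroup M) (hg : SmoothGroupFamily g) (D₀ : Den M) (θ₀ : Fun M) :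
    ∃ (Q : ℝ × ℝ → State M) (v : ℝ → Alg M),
      SmoothStateFamily Q ∧ SmoothAlgFamily v ∧
      (∀ e : ℝ, IsInducedBy s D₀ θ₀ (fun t => g (e, t)) (fun t => Q (e, t))) ∧
      IsGenerator g v ∧
      ∀ t : ℝ, velocity (fun e => Q (e, t)) 0 =
        constrainedVariation s (fun t => Q (0, t)) v t := by
  obtain ⟨Φ, G, h, eΦ, eG⟩ := exists_isDiffeoExtension hg
  obtain ⟨-, -, N, hN, eN⟩ := hg
  obtain ⟨D', hD', eD'⟩ := Smooth.exists_extension D₀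
  obtain ⟨θ', hθ', eθ'⟩ := Smooth.exists_extension θ₀
  have hΦ := h.contDiff
  have hG := h.contDiff_inv
  have hfG : ContDiff ℝ ∞ (fderiv ℝ G) := hG.fderiv_right (by simp)
  -- The push-forward uses the Jacobian of the inverse as a factor instead of dividing by that of
  -- `Φ`, which could vanish off `M`.
  let DD : (ℝ × ℝ) × Plane → ℝ := fun z =>
    D' (G z) * ((fderiv ℝ G z).comp (.inr ℝ (ℝ × ℝ) Plane)).det
  let TH : (ℝ × ℝ) × Plane → ℝ := fun z => θ' (G z) - s * N (z.1, G z)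
  have hDD : ContDiff ℝ ∞ DD :=
    (hD'.comp hG).mul (contDiff_det_plane (hfG.clm_comp contDiff_const))
  have hTH : ContDiff ℝ ∞ TH :=
    (hθ'.comp hG).sub (contDiff_const.mul (hN.comp (contDiff_fst.prodMk hG)))
  have hpS : ∀ a, ContDiff ℝ ∞ (pushDeriv G Φ a) := h.contDiff_pushDeriv hΦ
  have hpT : ∀ a, ContDiff ℝ ∞ (pushDeriv G N a) := h.contDiff_pushDeriv hN
  have hat : ∀ {F : Type} [NormedAddCommGroup F] [NormedSpace ℝ F] {f : (ℝ × ℝ) × Plane → F}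
      (_ : ContDiff ℝ ∞ f) (p : ℝ × ℝ), ContDiff ℝ ∞ fun y => f (p, y) :=
    fun hf p => hf.comp (contDiff_prodMk_right p)
  -- Parameters are `(ε, t)`: direction `(0, 1)` gives the velocities, direction `(1, 0)` the
  -- generators.
  let Q : ℝ × ℝ → State M := fun p =>
    { u := (Vec.ofFun (hat (hpS (0, 1)) p) (h.tangentTo_pushDeriv (0, 1) p),
        Smooth.ofFun M (hat (hpT (0, 1)) p))
      D := Smooth.ofFun M (hat hDD p)
      θ := Smooth.ofFun M (hat hTH p) }
  let v : ℝ → Alg M := fun t =>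
    (Vec.ofFun (hat (hpS (1, 0)) (0, t)) (h.tangentTo_pushDeriv (1, 0) (0, t)),
      Smooth.ofFun M (hat (hpT (1, 0)) (0, t)))
  have hemb : ContDiff ℝ ∞ fun z : ℝ × Plane => (((0 : ℝ), z.1), z.2) := by fun_prop
  have hce : ∀ t e : ℝ, HasDerivAt (fun r : ℝ => (r, t)) (1, 0) e := fun t e =>
    (hasDerivAt_id e).prodMk (hasDerivAt_const e t)
  have hct : ∀ e t : ℝ, HasDerivAt (fun τ : ℝ => (e, τ)) (0, 1) t := fun e t =>
    (hasDerivAt_const t e).prodMk (hasDerivAt_id t)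
  have hDmul : ∀ p, ∀ x ∈ M,
      DD (p, Φ (p, x)) * (fderiv ℝ (fun y => Φ (p, y)) x).det = D' x := fun p x hx => by
    have h1 := h.det_inv_mul_det hM p hx
    rw [fderiv_slice hG] at h1
    simp only [DD, h.left_inv p x hx]
    rw [mul_assoc, h1, mul_one]
  refine ⟨Q, v, ⟨⟨_, hpS (0, 1), fun _ _ => rfl⟩, ⟨_, hpT (0, 1), fun _ _ => rfl⟩,
    ⟨_, hDD, fun _ _ => rfl⟩, ⟨_, hTH, fun _ _ => rfl⟩⟩,
    ⟨⟨_, (hpS (1, 0)).comp hemb, fun _ _ => rfl⟩, ⟨_, (hpT (1, 0)).comp hemb, fun _ _ => rfl⟩⟩,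
    ?_, ?_, ?_⟩
  · intro e t x
    refine ⟨?_, ?_, ?_, ?_⟩
    · simp only [Q, vval_ofFun, eΦ]
      rw [h.pushDeriv_apply Φ _ _ x.2, (hasDerivAt_slice hΦ (hct e t) x).deriv]
    · simp only [Q, val_ofFun, eΦ, eN]
      rw [h.pushDeriv_apply N _ _ x.2, (hasDerivAt_slice hN (hct e t) x).deriv]
    · simp only [Q, val_ofFun, eΦ]
      have hdφ : (g (e, t)).dφ x = fderiv ℝ (fun y => Φ ((e, t), y)) x :=
        d_eq hM ⟨_, (g (e, t)).smooth_φ⟩ _ (hat hΦ _) (eΦ (e, t)) x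
      rw [hdφ, eD']
      exact hDmul _ _ x.2
    · simp only [Q, val_ofFun, TH, SliceGroup.cocycle, SliceGroup.inv_v, eθ', eG, eN]
      ring
  · intro t x
    refine ⟨?_, ?_⟩
    · simp only [v, vval_ofFun, eΦ]
      rw [h.pushDeriv_apply Φ _ _ x.2, (hasDerivAt_slice hΦ (hce t 0) x).deriv]
    · simp only [v, val_ofFun, eΦ, eN]
      rw [h.pushDeriv_apply N _ _ x.2, (hasDerivAt_slice hN (hce t 0) x).deriv]
  · intro t
    refine Variation.ext' (fun x => ?_) (fun x => ?_) (fun x => ?_) fun x => ?_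
    · simp only [velocity, constrainedVariation, ad, adVec, bracket, Q, v, vval_ofFun,
        dv_ofFun hM]
      rw [(hasDerivAt_slice (hpS (0, 1)) (hce t 0) x).deriv,
        (hasDerivAt_slice (hpS (1, 0)) (hct 0 t) x).deriv, fderiv_slice (hpS _),
        fderiv_slice (hpS _)]
      have := h.fderiv_pushDeriv_comm hΦ (1, 0) (0, 1) (0, t) x.2
      simp only [ContinuousLinearMap.comp_apply, ContinuousLinearMap.inr_apply]
      rw [eq_sub_of_add_eq this]
      abel
    · simp only [velocity, constrainedVariation, ad, lieFun, Q, v, vval_ofFun, val_ofFun,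
        d_ofFun hM]
      rw [(hasDerivAt_slice (hpT (0, 1)) (hce t 0) x).deriv,
        (hasDerivAt_slice (hpT (1, 0)) (hct 0 t) x).deriv, fderiv_slice (hpT _),
        fderiv_slice (hpT _)]
      have := h.fderiv_pushDeriv_comm hN (1, 0) (0, 1) (0, t) x.2
      simp only [ContinuousLinearMap.comp_apply, ContinuousLinearMap.inr_apply]
      linear_combination this
    · simp only [velocity, constrainedVariation, lieDen, Q, v, vval_ofFun, val_ofFun,
        d_ofFun hM, div_ofFun hM]
      rw [(hasDerivAt_slice hDD (hce t 0) x).deriv, fderiv_slice hDD]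
      have := h.continuity_equation hM hDD hDmul (0, t) (1, 0) x.2
      simp only [ContinuousLinearMap.comp_apply, ContinuousLinearMap.inr_apply]
      linear_combination this
    · simp only [velocity, constrainedVariation, lieFun, Q, v, vval_ofFun, val_ofFun, d_ofFun hM]
      rw [(hasDerivAt_slice hTH (hce t 0) x).deriv, fderiv_slice hTH]
      have hx := h.inv_mem (0, t) x x.2
      have h1 := h.fderiv_comp_apply hTH (0, t) (1, 0) hx
      -- At a fixed label, `ϑ_s` along the trajectory is `θ' - s N`, and only `N` depends on `ε`.
      -- Its `ε`-derivative, transported by `G`, is `v_T`.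
      have h2 := fderiv_param_eq_of_eq
        (f := fun z : (ℝ × ℝ) × Plane => TH (z.1, Φ z)) (k := fun z => θ' z.2 - s * N z)
        (hTH.comp (contDiff_fst.prodMk hΦ))
        ((hθ'.comp contDiff_snd).sub (contDiff_const.mul hN))
        (x := G ((0, t), x)) (fun p => by simp only [TH, h.left_inv p _ hx]) (0, t) (1, 0)
      have h3 : HasDerivAt (fun r : ℝ => θ' (G ((0, t), x)) - s * N ((r, t), G ((0, t), x)))
          (-(s * fderiv ℝ N ((0, t), G ((0, t), x)) ((1, 0), 0))) 0 :=
        ((hasDerivAt_slice hN (hce t 0) (G ((0, t), x))).const_mul s).const_sub _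
      have h4 := (hasDerivAt_slice (f := fun z : (ℝ × ℝ) × Plane => θ' z.2 - s * N z)
        ((hθ'.comp contDiff_snd).sub (contDiff_const.mul hN)) (hce t 0) (G ((0, t), x))).unique h3
      rw [h.right_inv _ _ x.2] at h1
      rw [h1, h4] at h2
      simp only [ContinuousLinearMap.comp_apply, ContinuousLinearMap.inr_apply]
      rw [show pushDeriv G N (1, 0) ((0, t), (x : Plane)) =
        fderiv ℝ N ((0, t), G ((0, t), x)) ((1, 0), 0) from rfl]
      linear_combination h2

end ConstrainedVariations

section Action

/-! ### The variation of the action -/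

/-- Differentiation under the integral sign for functions that are `C¹` near `{0} × [t₀, t₁]`. -/
theorem hasDerivAt_intervalIntegral_of_contDiffAt {f : ℝ × ℝ → ℝ} {t₀ t₁ : ℝ} (h01 : t₀ ≤ t₁)
    (hf : ∀ t ∈ Icc t₀ t₁, ContDiffAt ℝ 1 f (0, t)) :
    HasDerivAt (fun e => ∫ t in t₀..t₁, f (e, t))
      (∫ t in t₀..t₁, fderiv ℝ f (0, t) (1, 0)) 0 := by
  -- The points of `C¹` regularity form an open set, so by compactness of `[t₀, t₁]` one interval of
  -- `ε` works for all times; the `ε`-derivative is bounded on the resulting compact box.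
  let O : Set (ℝ × ℝ) := {p | ContDiffAt ℝ 1 f p}
  have hO : IsOpen O := isOpen_iff_mem_nhds.2 fun p hp => ContDiffAt.eventually hp (by simp)
  obtain ⟨A, B, hA, hB, h0A, hIB, hAB⟩ := generalized_tube_lemma (isCompact_singleton (x := (0 : ℝ)))
    (isCompact_Icc (a := t₀) (b := t₁)) hO (by
      rintro ⟨_, t⟩ ⟨rfl, ht⟩
      exact hf t ht)
  obtain ⟨r, hr, hrA⟩ := Metric.nhds_basis_closedBall.mem_iff.1 (hA.mem_nhds (h0A rfl))
  have hmem : ∀ e ∈ Metric.closedBall (0 : ℝ) r, ∀ t ∈ Icc t₀ t₁, ContDiffAt ℝ 1 f (e, t) :=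
    fun e he t ht => hAB ⟨hrA he, hIB ht⟩
  have hcf : ContinuousOn (fun p => fderiv ℝ f p (1, 0))
      (Metric.closedBall (0 : ℝ) r ×ˢ Icc t₀ t₁) := by
    rintro ⟨e, t⟩ ⟨he, ht⟩
    exact ((((hmem e he t ht).fderiv_right (m := 0) (by simp)).continuousAt).clm_apply
      continuousAt_const).continuousWithinAt
  obtain ⟨C, hC⟩ := ((isCompact_closedBall (0 : ℝ) r).prod isCompact_Icc).exists_bound_of_continuousOn
    hcf
  have hI : uIoc t₀ t₁ ⊆ Icc t₀ t₁ := by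
    rw [uIoc_of_le h01]
    exact Ioc_subset_Icc_self
  have hmeas : ∀ e ∈ Metric.closedBall (0 : ℝ) r, ContinuousOn (fun t => f (e, t)) (Icc t₀ t₁) :=
    fun e he t ht => ((hmem e he t ht).continuousAt.comp
      (Continuous.prodMk_right e).continuousAt).continuousWithinAt
  have h0 : (0 : ℝ) ∈ Metric.closedBall (0 : ℝ) r := Metric.mem_closedBall_self hr.le
  refine (intervalIntegral.hasDerivAt_integral_of_dominated_loc_of_deriv_le
    (F := fun e t => f (e, t)) (F' := fun e t => fderiv ℝ f (e, t) (1, 0)) (bound := fun _ => C)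
    (Metric.ball_mem_nhds 0 hr) ?_ ?_ ?_ ?_ ?_ ?_).2
  · filter_upwards [Metric.ball_mem_nhds 0 hr] with e he
    exact ((hmeas e (Metric.ball_subset_closedBall he)).mono hI).aestronglyMeasurable
      measurableSet_uIoc
  · exact ContinuousOn.intervalIntegrable_of_Icc h01 (hmeas 0 h0)
  · refine ContinuousOn.aestronglyMeasurable ?_ measurableSet_uIoc
    exact hcf.comp (Continuous.prodMk_right (0 : ℝ)).continuousOn fun t ht => ⟨h0, hI ht⟩
  · exact .of_forall fun t ht e he => hC (e, t) ⟨Metric.ball_subset_closedBall he, hI ht⟩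
  · exact intervalIntegrable_const
  · refine .of_forall fun t ht e he => ?_
    have h1 := (hmem e (Metric.ball_subset_closedBall he) t (hI ht)).differentiableAt
      (by simp)
    exact h1.hasFDerivAt.comp_hasDerivAt e ((hasDerivAt_id e).prodMk (hasDerivAt_const e t))

/-- Joint `C¹` regularity allows differentiation under the time integral. At each frozen `t`, the
curve `ε ↦ Q (ε, t)` is among those tested by the variational derivative, which identifies the
integrand. -/
theorem hasDerivAt_action {M : Set Plane} {ℓ : State M → ℝ} {t₀ t₁ : ℝ} (h01 : t₀ ≤ t₁)
    {q : ℝ → State M} {μ : ℝ → Costate M} (hC : IsC1Along ℓ t₀ t₁ q)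
    (hμ : ∀ t ∈ Icc t₀ t₁, IsVariationalDerivative ℓ (q t) (μ t)) {Q : ℝ × ℝ → State M}
    (hQ : IsDeformation q Q) :
    HasDerivAt (fun e => ∫ t in t₀..t₁, ℓ (Q (e, t)))
      (∫ t in t₀..t₁, pairing (μ t) (velocity (fun e => Q (e, t)) 0)) 0 := by
  refine (hasDerivAt_intervalIntegral_of_contDiffAt h01 (hC Q hQ)).congr_deriv ?_
  refine intervalIntegral.integral_congr fun t ht => ?_
  rw [uIcc_of_le h01] at ht
  have h1 : HasDerivAt (fun e => ℓ (Q (e, t))) (fderiv ℝ (fun p => ℓ (Q p)) (0, t) (1, 0)) 0 :=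
    HasFDerivAt.comp_hasDerivAt (l := fun p => ℓ (Q p)) (f := fun e : ℝ => (e, t)) 0
      (((hC Q hQ t ht).differentiableAt (by simp)).hasFDerivAt) ((hasDerivAt_id (0 : ℝ)).prodMk (hasDerivAt_const 0 t))
  obtain ⟨⟨⟨U, hU, eU⟩, ⟨T, hT, eT⟩, ⟨D, hD, eD⟩, ⟨K, hK, eK⟩⟩, hQ0, R, hR⟩ := hQ
  have hemb : ContDiff ℝ ∞ fun z : ℝ × Plane => ((z.1, t), z.2) := by fun_prop
  refine h1.unique (hμ t ht (fun e => Q (e, t)) ⟨?_, ?_, ?_, ?_⟩ (hQ0 t) ⟨R, fun e x hx => ?_⟩)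
  · exact ⟨_, hU.comp hemb, fun e x => eU (e, t) x⟩
  · exact ⟨_, hT.comp hemb, fun e x => eT (e, t) x⟩
  · exact ⟨_, hD.comp hemb, fun e x => eD (e, t) x⟩
  · exact ⟨_, hK.comp hemb, fun e x => eK (e, t) x⟩
  · exact hR (e, t) x hx

/-! ### Time-dependent fields on the plane -/

section TimeDependent

variable {F : Type*} [NormedAddCommGroup F] [NormedSpace ℝ F]

/-- The time derivative of a time-dependent field. -/
def dt (f : ℝ × Plane → F) (z : ℝ × Plane) : F := fderiv ℝ f z (1, 0)

/-- The spatial derivative of a time-dependent field. -/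
def dx (f : ℝ × Plane → F) (z : ℝ × Plane) : Plane →L[ℝ] F :=
  (fderiv ℝ f z).comp (.inr ℝ ℝ Plane)

/-- The spatial divergence of a time-dependent vector field. -/
def divx (U : ℝ × Plane → Plane) (z : ℝ × Plane) : ℝ :=
  ∑ i : Fin 2, dx U z (EuclideanSpace.single i 1) i

theorem contDiff_dt {f : ℝ × Plane → F} (hf : ContDiff ℝ ∞ f) : ContDiff ℝ ∞ (dt f) :=
  contDiff_fderiv_apply hf _

theorem contDiff_dx {f : ℝ × Plane → F} (hf : ContDiff ℝ ∞ f) : ContDiff ℝ ∞ (dx f) :=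
  (hf.fderiv_right (by simp)).clm_comp contDiff_const

theorem contDiff_divx {U : ℝ × Plane → Plane} (hU : ContDiff ℝ ∞ U) : ContDiff ℝ ∞ (divx U) :=
  ContDiff.sum fun i _ => (EuclideanSpace.proj i : Plane →L[ℝ] ℝ).contDiff.comp
    ((contDiff_dx hU).clm_apply contDiff_const)

theorem fderiv_slice_eq_dx {f : ℝ × Plane → F} (hf : ContDiff ℝ ∞ f) (t : ℝ) (x : Plane) :
    fderiv ℝ (fun y => f (t, y)) x = dx f (t, x) := fderiv_slice hf t x

theorem planeDiv_slice {U : ℝ × Plane → Plane} (hU : ContDiff ℝ ∞ U) (t : ℝ) (x : Plane) :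
    planeDiv (fun y => U (t, y)) x = divx U (t, x) := by
  simp only [planeDiv, divx, fderiv_slice_eq_dx hU]

theorem hasDerivAt_dt {f : ℝ × Plane → F} (hf : ContDiff ℝ ∞ f) (t : ℝ) (x : Plane) :
    HasDerivAt (fun τ => f (τ, x)) (dt f (t, x)) t :=
  hasDerivAt_slice hf (hasDerivAt_id t) x

theorem contDiff_at_time {f : ℝ × Plane → F} (hf : ContDiff ℝ ∞ f) (t : ℝ) :
    ContDiff ℝ ∞ fun x => f (t, x) := hf.comp (contDiff_prodMk_right t)

variable {M : Set Plane}

theorem d_eq_dx (hM : M ⊆ closure (interior M)) {a : ℝ → Smooth M F} {f : ℝ × Plane → F}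
    (hf : ContDiff ℝ ∞ f) (h : ∀ t x, val (a t) x = f (t, x)) (t : ℝ) (x : M) :
    d (a t) x = dx f (t, x) := by
  rw [d_eq hM (a t) _ (contDiff_at_time hf t) (h t), fderiv_slice_eq_dx hf]

theorem dv_eq_dx (hM : M ⊆ closure (interior M)) {a : ℝ → Vec M} {f : ℝ × Plane → Plane}
    (hf : ContDiff ℝ ∞ f) (h : ∀ t x, vval (a t) x = f (t, x)) (t : ℝ) (x : M) :
    dv (a t) x = dx f (t, x) := by
  rw [dv_eq hM (contDiff_at_time hf t) (h t), fderiv_slice_eq_dx hf]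

theorem div_eq_divx (hM : M ⊆ closure (interior M)) {a : ℝ → Vec M} {f : ℝ × Plane → Plane}
    (hf : ContDiff ℝ ∞ f) (h : ∀ t x, vval (a t) x = f (t, x)) (t : ℝ) (x : M) :
    div (a t) x = divx f (t, x) := by
  rw [div_eq hM (contDiff_at_time hf t) (h t), planeDiv_slice hf]

theorem deriv_eq_dt {a : ℝ → M → F} {f : ℝ × Plane → F}
    (hf : ContDiff ℝ ∞ f) (h : ∀ t x, a t x = f (t, (x : Plane))) (t : ℝ) (x : M) :
    deriv (fun τ => a τ x) t = dt f (t, x) := by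
  simp_rw [h]
  exact (hasDerivAt_dt hf t x).deriv

theorem fderiv_eq_zero_of_bdd_family {f : ℝ × Plane → F} {R : ℝ}
    (h : ∀ t x, R < ‖x‖ → f (t, x) = 0) (z : ℝ × Plane) (hz : R < ‖z.2‖) : fderiv ℝ f z = 0 := by
  have : f =ᶠ[nhds z] fun _ => 0 := by
    filter_upwards [(isOpen_lt continuous_const
      (continuous_norm.comp continuous_snd)).mem_nhds hz] with y hy
    exact h y.1 y.2 hy
  rw [this.fderiv_eq]
  simp

end TimeDependent

theorem integrableOn_prod_of_bdd {f : ℝ × Plane → ℝ} (hf : Continuous f) {R : ℝ}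
    (h : ∀ t x, R < ‖x‖ → f (t, x) = 0) (t₀ t₁ : ℝ) {M : Set Plane} (hM : IsClosed M) :
    Integrable f ((volume.restrict (Ioc t₀ t₁)).prod (volume.restrict M)) := by
  rw [Measure.prod_restrict]
  refine IntegrableOn.of_forall_sdiff_eq_zero (s := Icc t₀ t₁ ×ˢ Metric.closedBall (0 : Plane) R)
    (hf.continuousOn.integrableOn_compact (isCompact_Icc.prod (isCompact_closedBall _ _)))
    (measurableSet_Ioc.prod hM.measurableSet) ?_
  rintro ⟨t, x⟩ ⟨⟨ht, -⟩, hx⟩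
  refine h t x (lt_of_not_ge fun hle => hx ⟨Ioc_subset_Icc_self ht, ?_⟩)
  simpa using hle

theorem intervalIntegrable_setIntegral {f : ℝ × Plane → ℝ} (hf : Continuous f) {R : ℝ}
    (h : ∀ t x, R < ‖x‖ → f (t, x) = 0) {t₀ t₁ : ℝ} (h01 : t₀ ≤ t₁) {M : Set Plane}
    (hM : IsClosed M) :
    IntervalIntegrable (fun t => ∫ x in M, f (t, x)) volume t₀ t₁ := by
  rw [intervalIntegrable_iff_integrableOn_Ioc_of_le h01]
  exact (integrableOn_prod_of_bdd hf h t₀ t₁ hM).integral_prod_left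

/-- The total time derivative of a field that vanishes at the end times integrates to zero. -/
theorem intervalIntegral_setIntegral_dt {f : ℝ × Plane → ℝ} (hf : ContDiff ℝ ∞ f) {R : ℝ}
    (h : ∀ t x, R < ‖x‖ → f (t, x) = 0) {t₀ t₁ : ℝ} (h01 : t₀ ≤ t₁) {M : Set Plane}
    (hM : IsClosed M) (h0 : ∀ x ∈ M, f (t₀, x) = 0) (h1 : ∀ x ∈ M, f (t₁, x) = 0) :
    ∫ t in t₀..t₁, ∫ x in M, dt f (t, x) = 0 := by
  have hc := (contDiff_dt hf).continuous
  have hz : ∀ t x, R < ‖x‖ → dt f (t, x) = 0 := fun t x hx => by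
    simp [dt, fderiv_eq_zero_of_bdd_family h (t, x) hx]
  rw [intervalIntegral.integral_of_le h01,
    integral_integral_swap (f := fun t x => dt f (t, x)) (integrableOn_prod_of_bdd hc hz t₀ t₁ hM)]
  refine (setIntegral_congr_fun hM.measurableSet fun x hx => ?_).trans
    (integral_zero Plane ℝ)
  rw [← intervalIntegral.integral_of_le h01,
    intervalIntegral.integral_eq_sub_of_hasDerivAt (fun t _ => hasDerivAt_dt hf t x)
      ((hc.comp (Continuous.prodMk_left x)).intervalIntegrable _ _), h0 x hx, h1 x hx, sub_zero]

end Action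

section Equations

/-! ### The affine Euler–Poincaré equations in terms of extensions -/

/-- Extensions to the plane of the components of a smooth curve of states. -/
structure StateExtension {M : Set Plane} (q : ℝ → State M) where
  uS : ℝ × Plane → Plane
  uT : ℝ × Plane → ℝ
  D : ℝ × Plane → ℝ
  θ : ℝ × Plane → ℝ
  contDiff_uS : ContDiff ℝ ∞ uS
  contDiff_uT : ContDiff ℝ ∞ uT
  contDiff_D : ContDiff ℝ ∞ D
  contDiff_θ : ContDiff ℝ ∞ θ
  uS_eq : ∀ t (x : M), vval (q t).u.1 x = uS (t, x)
  uT_eq : ∀ t (x : M), val (q t).u.2 x = uT (t, x)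
  D_eq : ∀ t (x : M), val (q t).D x = D (t, x)
  θ_eq : ∀ t (x : M), val (q t).θ x = θ (t, x)

/-- Extensions to the plane of the components of a smooth curve of costates. -/
structure CostateExtension {M : Set Plane} (μ : ℝ → Costate M) where
  uS : ℝ × Plane → Plane →L[ℝ] ℝ
  uT : ℝ × Plane → ℝ
  D : ℝ × Plane → ℝ
  θ : ℝ × Plane → ℝ
  contDiff_uS : ContDiff ℝ ∞ uS
  contDiff_uT : ContDiff ℝ ∞ uT
  contDiff_D : ContDiff ℝ ∞ D
  contDiff_θ : ContDiff ℝ ∞ θ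
  uS_eq : ∀ t (x : M), val (μ t).uS x = uS (t, x)
  uT_eq : ∀ t (x : M), val (μ t).uT x = uT (t, x)
  D_eq : ∀ t (x : M), val (μ t).D x = D (t, x)
  θ_eq : ∀ t (x : M), val (μ t).θ x = θ (t, x)

/-- Extensions, with bounded support in space, of the components of a smooth curve in `𝔰`. -/
structure GeneratorExtension {M : Set Plane} (v : ℝ → Alg M) where
  vS : ℝ × Plane → Plane
  vT : ℝ × Plane → ℝ
  contDiff_vS : ContDiff ℝ ∞ vS
  contDiff_vT : ContDiff ℝ ∞ vT
  vS_eq : ∀ t (x : M), vval (v t).1 x = vS (t, x)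
  vT_eq : ∀ t (x : M), val (v t).2 x = vT (t, x)
  R : ℝ
  vS_zero : ∀ t x, R < ‖x‖ → vS (t, x) = 0
  vT_zero : ∀ t x, R < ‖x‖ → vT (t, x) = 0

variable {M : Set Plane} {q : ℝ → State M} {μ : ℝ → Costate M} {v : ℝ → Alg M}

theorem SmoothStateFamily.nonempty_extension (h : SmoothStateFamily q) :
    Nonempty (StateExtension q) := by
  obtain ⟨⟨U, hU, eU⟩, ⟨T, hT, eT⟩, ⟨D, hD, eD⟩, ⟨K, hK, eK⟩⟩ := h
  exact ⟨⟨U, T, D, K, hU, hT, hD, hK, eU, eT, eD, eK⟩⟩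

theorem SmoothCostateFamily.nonempty_extension (h : SmoothCostateFamily μ) :
    Nonempty (CostateExtension μ) := by
  obtain ⟨⟨U, hU, eU⟩, ⟨T, hT, eT⟩, ⟨D, hD, eD⟩, ⟨K, hK, eK⟩⟩ := h
  exact ⟨⟨U, T, D, K, hU, hT, hD, hK, eU, eT, eD, eK⟩⟩

theorem IsAdmissible.nonempty_extension {t₀ t₁ : ℝ} (h : IsAdmissible t₀ t₁ v) :
    Nonempty (GeneratorExtension v) := by
  obtain ⟨⟨h1, h2⟩, -, -, R, hR⟩ := h
  obtain ⟨V, hV, eV, R₁, h1'⟩ := h1.exists_extension_of_bddSupp fun t x hx => (hR t x hx).1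
  obtain ⟨W, hW, eW, R₂, h2'⟩ := h2.exists_extension_of_bddSupp fun t x hx => (hR t x hx).2
  exact ⟨⟨V, W, hV, hW, eV, eW, max R₁ R₂,
    fun t x hx => h1' t x ((le_max_left _ _).trans_lt hx),
    fun t x hx => h2' t x ((le_max_right _ _).trans_lt hx)⟩⟩

/-- The residual of the momentum equation. -/
def resS (E : StateExtension q) (C : CostateExtension μ) (z : ℝ × Plane) : Plane →L[ℝ] ℝ :=
  dt C.uS z + (dx C.uS z (E.uS z) + (C.uS z).comp (dx E.uS z) + divx E.uS z • C.uS z) -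
    (-(C.uT z • dx E.uT z) + E.D z • dx C.D z + -(C.θ z • dx E.θ z))

/-- The residual of the tracer equation. -/
def resT (s : ℝ) (E : StateExtension q) (C : CostateExtension μ) (z : ℝ × Plane) : ℝ :=
  dt C.uT z + (dx C.uT z (E.uS z) + C.uT z * divx E.uS z) + C.θ z * s

theorem continuous_resS (E : StateExtension q) (C : CostateExtension μ) :
    Continuous (resS E C) := by
  have h1 := (contDiff_dt C.contDiff_uS).continuous
  have h2 := (contDiff_dx C.contDiff_uS).continuous
  have h3 := (contDiff_dx E.contDiff_uS).continuous
  have h4 := (contDiff_divx E.contDiff_uS).continuous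
  have h5 := (contDiff_dx E.contDiff_uT).continuous
  have h6 := (contDiff_dx C.contDiff_D).continuous
  have h7 := (contDiff_dx E.contDiff_θ).continuous
  have h8 := C.contDiff_uS.continuous
  have h9 := C.contDiff_uT.continuous
  have h10 := C.contDiff_θ.continuous
  have h11 := E.contDiff_uS.continuous
  have h12 := E.contDiff_D.continuous
  unfold resS
  fun_prop

theorem continuous_resT (s : ℝ) (E : StateExtension q) (C : CostateExtension μ) :
    Continuous (resT s E C) := by
  have h1 := (contDiff_dt C.contDiff_uT).continuous
  have h2 := (contDiff_dx C.contDiff_uT).continuous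
  have h4 := (contDiff_divx E.contDiff_uS).continuous
  have h9 := C.contDiff_uT.continuous
  have h10 := C.contDiff_θ.continuous
  have h11 := E.contDiff_uS.continuous
  unfold resT
  fun_prop

/-- Derivatives on `M` are those of the extensions, so the equations become the vanishing on `[t₀,
t₁] × M` of residuals that are continuous on all of space-time, a form suited to test functions and
closure arguments. -/
theorem affineEulerPoincare_iff (hM : M ⊆ closure (interior M)) (s t₀ t₁ : ℝ)
    (E : StateExtension q) (C : CostateExtension μ) :
    AffineEulerPoincare s t₀ t₁ q μ ↔
      ∀ t ∈ Icc t₀ t₁, ∀ x ∈ M, resS E C (t, x) = 0 ∧ resT s E C (t, x) = 0 := by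
  unfold AffineEulerPoincare
  refine forall₂_congr fun t _ => ?_
  refine Iff.trans (b := ∀ x : M, resS E C (t, x) = 0 ∧ resT s E C (t, x) = 0)
    (forall_congr' fun x => ?_) Subtype.forall
  rw [deriv_eq_dt C.contDiff_uS C.uS_eq, deriv_eq_dt C.contDiff_uT C.uT_eq]
  simp only [adStar, diamondFun, diamondDen, lieDen, E.uS_eq, C.uS_eq, C.uT_eq, C.θ_eq,
    E.D_eq, d_eq_dx hM C.contDiff_uS C.uS_eq, d_eq_dx hM C.contDiff_uT C.uT_eq,
    d_eq_dx hM C.contDiff_D C.D_eq, d_eq_dx hM E.contDiff_uT E.uT_eq,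
    d_eq_dx hM E.contDiff_θ E.θ_eq, dv_eq_dx hM E.contDiff_uS E.uS_eq,
    div_eq_divx hM E.contDiff_uS E.uS_eq]
  rw [← sub_eq_zero, ← sub_eq_zero (b := -(C.θ (t, (x : Plane)) * s)), sub_neg_eq_add]
  rfl

/-! ### Integration by parts in the pairing with a constrained variation -/

/-- The momentum paired with the generator. -/
def noether (C : CostateExtension μ) (G : GeneratorExtension v) (z : ℝ × Plane) : ℝ :=
  C.uS z (G.vS z) + C.uT z * G.vT z

theorem contDiff_noether (C : CostateExtension μ) (G : GeneratorExtension v) :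
    ContDiff ℝ ∞ (noether C G) :=
  (C.contDiff_uS.clm_apply G.contDiff_vS).add (C.contDiff_uT.mul G.contDiff_vT)

theorem noether_zero (C : CostateExtension μ) (G : GeneratorExtension v) (t : ℝ) (x : Plane)
    (hx : G.R < ‖x‖) : noether C G (t, x) = 0 := by
  simp [noether, G.vS_zero t x hx, G.vT_zero t x hx]

theorem fderiv_noether (C : CostateExtension μ) (G : GeneratorExtension v) (z w : ℝ × Plane) :
    fderiv ℝ (noether C G) z w = fderiv ℝ C.uS z w (G.vS z) + C.uS z (fderiv ℝ G.vS z w) +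
      (fderiv ℝ C.uT z w * G.vT z + C.uT z * fderiv ℝ G.vT z w) := by
  have h1 := C.contDiff_uS.differentiable (by simp) z
  have h2 := G.contDiff_vS.differentiable (by simp) z
  have h3 := C.contDiff_uT.differentiable (by simp) z
  have h4 := G.contDiff_vT.differentiable (by simp) z
  have : fderiv ℝ (noether C G) z = _ :=
    fderiv_fun_add (h1.clm_apply h2) (h3.mul h4)
  rw [this, fderiv_clm_apply h1 h2, fderiv_fun_mul h3 h4]
  simp
  ring

/-- The velocity component of the constrained variation, extended to the plane. -/
def varS (E : StateExtension q) (G : GeneratorExtension v) (z : ℝ × Plane) : Plane :=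
  dt G.vS z + (dx G.vS z (E.uS z) - dx E.uS z (G.vS z))

/-- The tracer velocity component of the constrained variation, extended to the plane. -/
def varT (E : StateExtension q) (G : GeneratorExtension v) (z : ℝ × Plane) : ℝ :=
  dt G.vT z - (dx E.uT z (G.vS z) - dx G.vT z (E.uS z))

/-- The density component of the constrained variation, extended to the plane. -/
def varD (E : StateExtension q) (G : GeneratorExtension v) (z : ℝ × Plane) : ℝ :=
  -(dx E.D z (G.vS z) + E.D z * divx G.vS z)

/-- The scalar field component of the constrained variation, extended to the plane. -/
def varθ (s : ℝ) (E : StateExtension q) (G : GeneratorExtension v) (z : ℝ × Plane) : ℝ :=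
  -dx E.θ z (G.vS z) - s * G.vT z

section Var

variable (s : ℝ) (E : StateExtension q) (G : GeneratorExtension v)

theorem contDiff_varS : ContDiff ℝ ∞ (varS E G) :=
  (contDiff_dt G.contDiff_vS).add (((contDiff_dx G.contDiff_vS).clm_apply E.contDiff_uS).sub
    ((contDiff_dx E.contDiff_uS).clm_apply G.contDiff_vS))

theorem contDiff_varT : ContDiff ℝ ∞ (varT E G) :=
  (contDiff_dt G.contDiff_vT).sub (((contDiff_dx E.contDiff_uT).clm_apply G.contDiff_vS).sub
    ((contDiff_dx G.contDiff_vT).clm_apply E.contDiff_uS))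

theorem contDiff_varD : ContDiff ℝ ∞ (varD E G) :=
  (((contDiff_dx E.contDiff_D).clm_apply G.contDiff_vS).add
    (E.contDiff_D.mul (contDiff_divx G.contDiff_vS))).neg

theorem contDiff_varθ : ContDiff ℝ ∞ (varθ s E G) :=
  ((contDiff_dx E.contDiff_θ).clm_apply G.contDiff_vS).neg.sub (contDiff_const.mul G.contDiff_vT)

/-- The constrained variation vanishes outside the support of the generator. -/
theorem var_eq_zero {z : ℝ × Plane} (hS : G.vS =ᶠ[nhds z] fun _ => 0)
    (hT : G.vT =ᶠ[nhds z] fun _ => 0) :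
    varS E G z = 0 ∧ varT E G z = 0 ∧ varD E G z = 0 ∧ varθ s E G z = 0 := by
  simp [varS, varT, varD, varθ, dt, dx, divx, hS.fderiv_eq, hT.fderiv_eq, hS.eq_of_nhds,
    hT.eq_of_nhds, show ((0 : ℝ), (0 : Plane)) = 0 from rfl]

theorem var_eq_zero_of_lt {z : ℝ × Plane} (hz : G.R < ‖z.2‖) :
    varS E G z = 0 ∧ varT E G z = 0 ∧ varD E G z = 0 ∧ varθ s E G z = 0 := by
  have h := (isOpen_lt continuous_const (continuous_norm.comp continuous_snd)).mem_nhds hz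
  refine var_eq_zero s E G ?_ ?_
  · filter_upwards [h] with y hy using G.vS_zero y.1 y.2 hy
  · filter_upwards [h] with y hy using G.vT_zero y.1 y.2 hy

theorem constrainedVariation_eq (hM : M ⊆ closure (interior M)) (t : ℝ) :
    constrainedVariation s q v t =
      ⟨fun x => varS E G (t, x), fun x => varT E G (t, x), fun x => varD E G (t, x),
        fun x => varθ s E G (t, x)⟩ := by
  refine Variation.ext' (fun x => ?_) (fun x => ?_) (fun x => ?_) fun x => ?_
  · simp only [constrainedVariation, ad, adVec, bracket, varS]
    rw [deriv_eq_dt G.contDiff_vS G.vS_eq, dv_eq_dx hM (a := fun t => (q t).u.1) E.contDiff_uS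
      E.uS_eq, dv_eq_dx hM (a := fun t => (v t).1) G.contDiff_vS G.vS_eq, G.vS_eq, E.uS_eq,
      sub_neg_eq_add]
  · simp only [constrainedVariation, ad, lieFun, varT]
    rw [deriv_eq_dt G.contDiff_vT G.vT_eq, d_eq_dx hM (a := fun t => (q t).u.2) E.contDiff_uT
      E.uT_eq, d_eq_dx hM (a := fun t => (v t).2) G.contDiff_vT G.vT_eq, G.vS_eq, E.uS_eq]
  · simp only [constrainedVariation, lieDen, varD]
    rw [d_eq_dx hM (a := fun t => (q t).D) E.contDiff_D E.D_eq,
      div_eq_divx hM (a := fun t => (v t).1) G.contDiff_vS G.vS_eq, G.vS_eq, E.D_eq]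
  · simp only [constrainedVariation, lieFun, varθ]
    rw [d_eq_dx hM (a := fun t => (q t).θ) E.contDiff_θ E.θ_eq, G.vS_eq, G.vT_eq]

end Var

/-- The residuals paired with the generator. -/
def resPair (s : ℝ) (E : StateExtension q) (C : CostateExtension μ) (G : GeneratorExtension v)
    (z : ℝ × Plane) : ℝ :=
  resS E C z (G.vS z) + resT s E C z * G.vT z

theorem continuous_resPair (s : ℝ) (E : StateExtension q) (C : CostateExtension μ)
    (G : GeneratorExtension v) : Continuous (resPair s E C G) :=
  ((continuous_resS E C).clm_apply G.contDiff_vS.continuous).add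
    ((continuous_resT s E C).mul G.contDiff_vT.continuous)

theorem resPair_zero (s : ℝ) (E : StateExtension q) (C : CostateExtension μ)
    (G : GeneratorExtension v) (t : ℝ) (x : Plane) (hx : G.R < ‖x‖) :
    resPair s E C G (t, x) = 0 := by
  simp [resPair, G.vS_zero t x hx, G.vT_zero t x hx]

/-- The pointwise form of the integration by parts. -/
theorem pairing_integrand_eq (s : ℝ) (E : StateExtension q) (C : CostateExtension μ)
    (G : GeneratorExtension v) (z : ℝ × Plane) :
    C.uS z (varS E G z) + C.uT z * varT E G z + C.D z * varD E G z + C.θ z * varθ s E G z =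
      dt (noether C G) z - resPair s E C G z +
        (dx (noether C G) z (E.uS z) + noether C G z * divx E.uS z) -
        (dx (fun z => C.D z * E.D z) z (G.vS z) + C.D z * E.D z * divx G.vS z) := by
  have h1 : fderiv ℝ (fun z => C.D z * E.D z) z = _ :=
    fderiv_fun_mul (C.contDiff_D.differentiable (by simp) z)
      (E.contDiff_D.differentiable (by simp) z)
  -- Only the product rule is involved. The divergence of `noether` times `u_S` absorbs the terms of
  -- `ad*` and of `𝓛_{u_S}`; the divergence of `(δℓ/δD) D v_S` turns the variation of the density
  -- into its diamond.
  simp only [dt, dx, resPair, resS, resT, varS, varT, varD, varθ, fderiv_noether, noether, h1,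
    ContinuousLinearMap.comp_apply, ContinuousLinearMap.inr_apply, add_apply,
    sub_apply, neg_apply, smul_apply, smul_eq_mul, map_add, map_sub]
  ring

/-- The divergence terms drop out: one field is a multiple of `u_S`, the other of `v_S`, both
tangent to `M`, and both have bounded support thanks to the generator. -/
theorem pairing_constrainedVariation (hM : IsClosed M) (hM' : M ⊆ closure (interior M)) (s : ℝ)
    (E : StateExtension q) (C : CostateExtension μ) (G : GeneratorExtension v) (t : ℝ) :
    pairing (μ t) (constrainedVariation s q v t) =
      (∫ x in M, dt (noether C G) (t, x)) - ∫ x in M, resPair s E C G (t, x) := by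
  have cS := (contDiff_varS E G).continuous
  have cT := (contDiff_varT E G).continuous
  have cD := (contDiff_varD E G).continuous
  have cθ := (contDiff_varθ s E G).continuous
  have c1 := C.contDiff_uS.continuous
  have c2 := C.contDiff_uT.continuous
  have c3 := C.contDiff_D.continuous
  have c4 := C.contDiff_θ.continuous
  have hz := fun x (hx : G.R < ‖x‖) => var_eq_zero_of_lt s E G (z := (t, x)) hx
  have i1 : IntegrableOn (fun x => C.uS (t, x) (varS E G (t, x))) M :=
    integrableOn_of_bdd (by fun_prop) (R := G.R) (fun x hx => by simp [(hz x hx).1]) M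
  have i2 : IntegrableOn (fun x => C.uT (t, x) * varT E G (t, x)) M :=
    integrableOn_of_bdd (by fun_prop) (R := G.R) (fun x hx => by simp [(hz x hx).2.1]) M
  have i3 : IntegrableOn (fun x => C.D (t, x) * varD E G (t, x)) M :=
    integrableOn_of_bdd (by fun_prop) (R := G.R) (fun x hx => by simp [(hz x hx).2.2.1]) M
  have i4 : IntegrableOn (fun x => C.θ (t, x) * varθ s E G (t, x)) M :=
    integrableOn_of_bdd (by fun_prop) (R := G.R) (fun x hx => by simp [(hz x hx).2.2.2]) M
  have i12 : IntegrableOn (fun x => C.uS (t, x) (varS E G (t, x)) +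
      C.uT (t, x) * varT E G (t, x)) M := i1.add i2
  have i123 : IntegrableOn (fun x => C.uS (t, x) (varS E G (t, x)) +
      C.uT (t, x) * varT E G (t, x) + C.D (t, x) * varD E G (t, x)) M := i12.add i3
  have hn := contDiff_noether C G
  have hfn := fun x (hx : G.R < ‖x‖) =>
    fderiv_eq_zero_of_bdd_family (noether_zero C G) (t, x) hx
  have hfv := fun x (hx : G.R < ‖x‖) => fderiv_eq_zero_of_bdd_family G.vS_zero (t, x) hx
  have hc : ContDiff ℝ ∞ fun z => C.D z * E.D z := C.contDiff_D.mul E.contDiff_D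
  have j1 : IntegrableOn (fun x => dt (noether C G) (t, x)) M := by
    have := (contDiff_dt hn).continuous
    exact integrableOn_of_bdd (by fun_prop) (R := G.R) (fun x hx => by simp [dt, hfn x hx]) M
  have j2 : IntegrableOn (fun x => resPair s E C G (t, x)) M := by
    have := continuous_resPair s E C G
    exact integrableOn_of_bdd (by fun_prop) (R := G.R)
      (fun x hx => resPair_zero s E C G t x hx) M
  have j3 : IntegrableOn (fun x => dx (noether C G) (t, x) (E.uS (t, x)) +
      noether C G (t, x) * divx E.uS (t, x)) M := by
    have := (contDiff_dx hn).continuous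
    have := hn.continuous
    have := E.contDiff_uS.continuous
    have := (contDiff_divx E.contDiff_uS).continuous
    exact integrableOn_of_bdd (by fun_prop) (R := G.R)
      (fun x hx => by simp [dx, hfn x hx, noether_zero C G t x hx]) M
  have j4 : IntegrableOn (fun x => dx (fun z => C.D z * E.D z) (t, x) (G.vS (t, x)) +
      C.D (t, x) * E.D (t, x) * divx G.vS (t, x)) M := by
    have := (contDiff_dx hc).continuous
    have := E.contDiff_D.continuous
    have := G.contDiff_vS.continuous
    have := (contDiff_divx G.contDiff_vS).continuous
    exact integrableOn_of_bdd (by fun_prop) (R := G.R)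
      (fun x hx => by 
        simp [divx, dx, hfv x hx, G.vS_zero t x hx, show ((0 : ℝ), (0 : Plane)) = 0 from rfl]) M
  have d1 := setIntegral_div_smul_eq_zero hM (contDiff_at_time hn t)
    (contDiff_at_time E.contDiff_uS t) (tangentTo_of_eq (E.uS_eq t)) (R := G.R)
    (fun x hx => by simp [noether_zero C G t x hx])
  have d2 := setIntegral_div_smul_eq_zero hM (contDiff_at_time hc t)
    (contDiff_at_time G.contDiff_vS t) (tangentTo_of_eq (G.vS_eq t)) (R := G.R)
    (fun x hx => by simp [G.vS_zero t x hx])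
  simp only [fderiv_slice_eq_dx hn, planeDiv_slice E.contDiff_uS, fderiv_slice_eq_dx hc,
    planeDiv_slice G.contDiff_vS] at d1 d2
  rw [constrainedVariation_eq s E G hM', pairing, pairVec, pairFun, pairFun, pairFun,
    integral_area_eq hM (g := fun x => C.uS (t, x) (varS E G (t, x)))
      (fun x => by rw [C.uS_eq]),
    integral_area_eq hM (g := fun x => C.uT (t, x) * varT E G (t, x))
      (fun x => by rw [C.uT_eq]),
    integral_area_eq hM (g := fun x => C.D (t, x) * varD E G (t, x))
      (fun x => by rw [C.D_eq]),
    integral_area_eq hM (g := fun x => C.θ (t, x) * varθ s E G (t, x))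
      (fun x => by rw [C.θ_eq]),
    ← integral_add i1 i2, ← integral_add i12 i3, ← integral_add i123 i4]
  simp only [pairing_integrand_eq]
  have j12 : IntegrableOn (fun x => dt (noether C G) (t, x) - resPair s E C G (t, x)) M :=
    j1.sub j2
  have j123 : IntegrableOn (fun x => dt (noether C G) (t, x) - resPair s E C G (t, x) +
      (dx (noether C G) (t, x) (E.uS (t, x)) + noether C G (t, x) * divx E.uS (t, x))) M :=
    j12.add j3
  rw [integral_sub j123 j4, integral_add j12 j3, integral_sub j1 j2, d1, d2]
  ring

/-- The first variation formula: the end-time terms vanish with the generator, which leaves the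
residuals as the gradient of the action. -/
theorem intervalIntegral_pairing (hM : IsClosed M) (hM' : M ⊆ closure (interior M)) (s : ℝ)
    {t₀ t₁ : ℝ} (h01 : t₀ ≤ t₁) (E : StateExtension q) (C : CostateExtension μ)
    (G : GeneratorExtension v) (hv : IsAdmissible t₀ t₁ v) :
    ∫ t in t₀..t₁, pairing (μ t) (constrainedVariation s q v t) =
      -∫ t in t₀..t₁, ∫ x in M, resPair s E C G (t, x) := by
  simp only [pairing_constrainedVariation hM hM' s E C G]
  have hn := contDiff_noether C G
  have hend : ∀ t, v t = 0 → ∀ x ∈ M, noether C G (t, x) = 0 := by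
    intro t ht x hx
    have h1 := G.vS_eq t ⟨x, hx⟩
    have h2 := G.vT_eq t ⟨x, hx⟩
    rw [ht] at h1 h2
    rw [noether, ← h1, ← h2]
    simp [vval, val]
  rw [intervalIntegral.integral_sub, intervalIntegral_setIntegral_dt hn (noether_zero C G) h01 hM
    (hend t₀ hv.2.1) (hend t₁ hv.2.2.1), zero_sub]
  · refine intervalIntegrable_setIntegral (contDiff_dt hn).continuous (R := G.R)
      (fun t x hx => ?_) h01 hM
    simp [dt, fderiv_eq_zero_of_bdd_family (noether_zero C G) (t, x) hx]
  · exact intervalIntegrable_setIntegral (continuous_resPair s E C G)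
      (resPair_zero s E C G) h01 hM

end Equations

section Hamilton

/-! ### Hamilton's principle -/

variable {M : Set Plane} {q : ℝ → State M} {μ : ℝ → Costate M}

/-- Tangency is no restriction at interior points, where a short segment in the direction `f p`
stays in `M`, and it is trivial where `f` vanishes. Test fields supported in the interior are thus
unconstrained. -/
theorem tangentTo_of_eq_zero {f : Plane → Plane} (h : ∀ x, x ∉ interior M → f x = 0) :
    TangentTo M f := by
  intro p hp y hy
  by_cases hpi : p ∈ interior M
  · have hγ := hasDerivAt_line p (f p)
    have hev : ∀ᶠ τ : ℝ in nhds 0, p + τ • f p ∈ M := by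
      have h1 : Filter.Tendsto (fun τ : ℝ => p + τ • f p) (nhds 0) (nhds p) := by
        simpa using hγ.continuousAt.tendsto
      exact h1.eventually (mem_interior_iff_mem_nhds.1 hpi)
    have h2 := inner_velocity_eq_zero (y := y) hγ hev
    simp only [zero_smul, add_zero] at h2
    exact h2 hy
  · simp [h p hpi]

theorem hamiltonPrinciple_of_affineEulerPoincare (hM : IsClosed M)
    (hM' : M ⊆ closure (interior M)) (s : ℝ) {ℓ : State M → ℝ} {t₀ t₁ : ℝ} (h01 : t₀ ≤ t₁)
    (E : StateExtension q) (C : CostateExtension μ) (hC : IsC1Along ℓ t₀ t₁ q)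
    (hμ : ∀ t ∈ Icc t₀ t₁, IsVariationalDerivative ℓ (q t) (μ t))
    (h : AffineEulerPoincare s t₀ t₁ q μ) : HamiltonPrinciple s ℓ t₀ t₁ q := by
  intro Q v hQ hv hvar
  obtain ⟨G⟩ := hv.nonempty_extension
  refine (hasDerivAt_action h01 hC hμ hQ).congr_deriv ?_
  have h1 : ∫ t in t₀..t₁, pairing (μ t) (velocity (fun e => Q (e, t)) 0) =
      ∫ t in t₀..t₁, pairing (μ t) (constrainedVariation s q v t) :=
    intervalIntegral.integral_congr fun t ht => by
      rw [uIcc_of_le h01] at ht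
      simp only [hvar t ht]
  rw [h1, intervalIntegral_pairing hM hM' s h01 E C G hv, neg_eq_zero]
  rw [affineEulerPoincare_iff hM' s t₀ t₁ E C] at h
  have h2 : ∫ t in t₀..t₁, ∫ x in M, resPair s E C G (t, x) = ∫ _ in t₀..t₁, (0 : ℝ) :=
    intervalIntegral.integral_congr fun t ht => by
      rw [uIcc_of_le h01] at ht
      refine (setIntegral_congr_fun hM.measurableSet fun x hx => ?_).trans (integral_zero Plane ℝ)
      simp [resPair, h t ht x hx]
  rw [h2, intervalIntegral.integral_zero]

/-- The deformation `q + ε w`, where `w` is the constrained variation of a generator supported in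
the interior. -/
theorem exists_deformation (hM' : M ⊆ closure (interior M)) (s : ℝ) (E : StateExtension q)
    {v : ℝ → Alg M} (G : GeneratorExtension v)
    (hG : ∀ t x, x ∉ interior M → varS E G (t, x) = 0) :
    ∃ Q : ℝ × ℝ → State M, IsDeformation q Q ∧
      ∀ t, velocity (fun e => Q (e, t)) 0 = constrainedVariation s q v t := by
  have cS := contDiff_varS E G
  have cT := contDiff_varT E G
  have cD := contDiff_varD E G
  have cθ := contDiff_varθ s E G
  -- A straight line in the linear space of states; the vanishing of `varS` off the interior keeps
  -- its vector field component tangent.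
  let Q : ℝ × ℝ → State M := fun p =>
    { u := ((q p.2).u.1 +
          p.1 • Vec.ofFun (contDiff_at_time cS p.2) (tangentTo_of_eq_zero (hG p.2)),
        (q p.2).u.2 + p.1 • Smooth.ofFun M (contDiff_at_time cT p.2))
      D := (q p.2).D + p.1 • Smooth.ofFun M (contDiff_at_time cD p.2)
      θ := (q p.2).θ + p.1 • Smooth.ofFun M (contDiff_at_time cθ p.2) }
  have eS : ∀ p x, vval (Q p).u.1 x = vval (q p.2).u.1 x + p.1 • varS E G (p.2, x) :=
    fun _ _ => rfl
  have eT : ∀ p x, val (Q p).u.2 x = val (q p.2).u.2 x + p.1 • varT E G (p.2, x) :=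
    fun _ _ => rfl
  have eD : ∀ p x, val (Q p).D x = val (q p.2).D x + p.1 • varD E G (p.2, x) := fun _ _ => rfl
  have eθ : ∀ p x, val (Q p).θ x = val (q p.2).θ x + p.1 • varθ s E G (p.2, x) := fun _ _ => rfl
  have hfam : ∀ {F : Type} [NormedAddCommGroup F] [NormedSpace ℝ F] {f w : ℝ × Plane → F},
      ContDiff ℝ ∞ f → ContDiff ℝ ∞ w →
      ContDiff ℝ ∞ fun z : (ℝ × ℝ) × Plane => f (z.1.2, z.2) + z.1.1 • w (z.1.2, z.2) := by
    intro F _ _ f w hf hw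
    have h1 : ContDiff ℝ ∞ fun z : (ℝ × ℝ) × Plane => (z.1.2, z.2) := by fun_prop
    have h2 : ContDiff ℝ ∞ fun z : (ℝ × ℝ) × Plane => z.1.1 := by fun_prop
    exact (hf.comp h1).add (h2.smul (hw.comp h1))
  have hder : ∀ {F : Type} [NormedAddCommGroup F] [NormedSpace ℝ F] (a b : F),
      deriv (fun r : ℝ => a + r • b) 0 = b := by
    intro F _ _ a b
    have h1 : HasDerivAt (fun r : ℝ => a + r • b) ((1 : ℝ) • b) 0 :=
      ((hasDerivAt_id (0 : ℝ)).smul_const b).const_add a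
    rw [h1.deriv, one_smul]
  refine ⟨Q, ⟨⟨?_, ?_, ?_, ?_⟩, fun t => ?_, G.R, fun p x hx => ?_⟩, fun t => ?_⟩
  · exact ⟨_, hfam E.contDiff_uS cS, fun p x => by simp only [eS, E.uS_eq]⟩
  · exact ⟨_, hfam E.contDiff_uT cT, fun p x => by simp only [eT, E.uT_eq]⟩
  · exact ⟨_, hfam E.contDiff_D cD, fun p x => by simp only [eD, E.D_eq]⟩
  · exact ⟨_, hfam E.contDiff_θ cθ, fun p x => by simp only [eθ, E.θ_eq]⟩
  · simp only [Q, zero_smul, add_zero]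
  · obtain ⟨h1, h2, h3, h4⟩ := var_eq_zero_of_lt s E G (z := (p.2, (x : Plane))) hx
    refine ⟨?_, ?_, ?_, ?_⟩
    · rw [eS, h1, smul_zero, add_zero]
    · rw [eT, h2, smul_zero, add_zero]
    · rw [eD, h3, smul_zero, add_zero]
    · rw [eθ, h4, smul_zero, add_zero]
  · rw [constrainedVariation_eq s E G hM']
    refine Variation.ext' (fun x => ?_) (fun x => ?_) (fun x => ?_) fun x => ?_
    · simp only [velocity, eS, hder]
    · simp only [velocity, eT, hder]
    · simp only [velocity, eD, hder]
    · simp only [velocity, eθ, hder]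

/-- Hamilton's principle implies the weak form of the equations, for test fields supported in the
interior. -/
theorem HamiltonPrinciple.weak_form (hM : IsClosed M)
    (hM' : M ⊆ closure (interior M)) {s : ℝ} {ℓ : State M → ℝ} {t₀ t₁ : ℝ} (h01 : t₀ ≤ t₁)
    (E : StateExtension q) (C : CostateExtension μ) (hC : IsC1Along ℓ t₀ t₁ q)
    (hμ : ∀ t ∈ Icc t₀ t₁, IsVariationalDerivative ℓ (q t) (μ t))
    (h : HamiltonPrinciple s ℓ t₀ t₁ q) {V : ℝ × Plane → Plane} {W : ℝ × Plane → ℝ}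
    (hV : ContDiff ℝ ∞ V) (hW : ContDiff ℝ ∞ W) {K : Set (ℝ × Plane)} (hK : IsCompact K)
    (hKO : K ⊆ Ioo t₀ t₁ ×ˢ interior M) (hVK : ∀ z ∉ K, V z = 0) (hWK : ∀ z ∉ K, W z = 0) :
    ∫ z, (resS E C z (V z) + resT s E C z * W z) = 0 := by
  obtain ⟨R, hR⟩ := hK.isBounded.exists_norm_le
  have hout : ∀ (t : ℝ) (x : Plane), R < ‖x‖ → (t, x) ∉ K := fun t x hx hmem =>
    absurd ((norm_snd_le (t, x)).trans (hR _ hmem)) (not_le.2 hx)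
  have hint : ∀ (t : ℝ) (x : Plane), x ∉ interior M → (t, x) ∉ K := fun t x hx hmem =>
    hx (hKO hmem).2
  have htime : ∀ (t : ℝ) (x : Plane), t ∉ Ioo t₀ t₁ → (t, x) ∉ K := fun t x hx hmem =>
    hx (hKO hmem).1
  let v : ℝ → Alg M := fun t =>
    (Vec.ofFun (contDiff_at_time hV t) (tangentTo_of_eq_zero fun x hx => hVK _ (hint t x hx)),
      Smooth.ofFun M (contDiff_at_time hW t))
  let G : GeneratorExtension v := ⟨V, W, hV, hW, fun _ _ => rfl, fun _ _ => rfl, R,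
    fun t x hx => hVK _ (hout t x hx), fun t x hx => hWK _ (hout t x hx)⟩
  have hv0 : ∀ t ∉ Ioo t₀ t₁, v t = 0 := fun t ht =>
    Prod.ext (Subtype.ext (Subtype.ext (funext fun x => hVK _ (htime t x ht))))
      (Subtype.ext (funext fun x => hWK _ (htime t x ht)))
  have hv : IsAdmissible t₀ t₁ v :=
    ⟨⟨⟨V, hV, fun _ _ => rfl⟩, ⟨W, hW, fun _ _ => rfl⟩⟩, hv0 t₀ (by simp), hv0 t₁ (by simp), R,
      fun t x hx => ⟨hVK _ (hout t x hx), hWK _ (hout t x hx)⟩⟩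
  -- The complement of `K` is open, so the generator vanishes near each of its points and its
  -- derivatives vanish there too.
  have hev : ∀ z ∉ K, ∀ᶠ y in nhds z, y ∉ K := fun z hz => hK.isClosed.isOpen_compl.mem_nhds hz
  obtain ⟨Q, hQ, hvel⟩ := exists_deformation hM' s E G fun t x hx =>
    (var_eq_zero s E G ((hev _ (hint t x hx)).mono hVK) ((hev _ (hint t x hx)).mono hWK)).1
  have h1 := (h Q v hQ hv fun t _ => hvel t).unique (hasDerivAt_action h01 hC hμ hQ)
  simp only [hvel] at h1
  rw [intervalIntegral_pairing hM hM' s h01 E C G hv, eq_comm, neg_eq_zero] at h1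
  have hz : ∀ z ∉ K, resPair s E C G z = 0 := fun z hz => by
    simp [resPair, G, hVK z hz, hWK z hz]
  have hi : Integrable (resPair s E C G) :=
    (continuous_resPair s E C G).integrable_of_hasCompactSupport (HasCompactSupport.intro hK hz)
  change ∫ z, resPair s E C G z = 0
  rw [Measure.volume_eq_prod] at hi ⊢
  -- The support in `K ⊆ Ioo t₀ t₁ ×ˢ interior M` makes the integral over all of space-time equal to
  -- the iterated one over `(t₀, t₁]` and `M`.
  rw [integral_prod _ hi, ← h1, intervalIntegral.integral_of_le h01,
    ← setIntegral_eq_integral_of_forall_compl_eq_zero (s := Ioc t₀ t₁)]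
  · refine setIntegral_congr_fun measurableSet_Ioc fun t _ => ?_
    exact (setIntegral_eq_integral_of_forall_compl_eq_zero fun x hx =>
      hz _ (hint t x fun h => hx (interior_subset h))).symm
  · intro t ht
    have : ∀ x, resPair s E C G (t, x) = 0 := fun x =>
      hz _ (htime t x fun h => ht (Ioo_subset_Ioc_self h))
    simp [this]

/-- The fundamental lemma of the calculus of variations on `[t₀, t₁] × M`. -/
theorem eq_zero_of_forall_integral_eq_zero (hM' : M ⊆ closure (interior M)) {t₀ t₁ : ℝ}
    (h01 : t₀ < t₁) {f : ℝ × Plane → ℝ} (hf : Continuous f)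
    (h : ∀ g : ℝ × Plane → ℝ, ContDiff ℝ ∞ g → HasCompactSupport g →
      tsupport g ⊆ Ioo t₀ t₁ ×ˢ interior M → ∫ z, g z • f z = 0) :
    ∀ t ∈ Icc t₀ t₁, ∀ x ∈ M, f (t, x) = 0 := by
  have hO : IsOpen (Ioo t₀ t₁ ×ˢ interior M) := isOpen_Ioo.prod isOpen_interior
  have h1 := hO.ae_eq_zero_of_integral_contDiff_smul_eq_zero (μ := volume)
    (hf.locallyIntegrable.locallyIntegrableOn _) h
  have h2 : f =ᵐ[volume.restrict (Ioo t₀ t₁ ×ˢ interior M)] fun _ => 0 :=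
    (ae_restrict_iff' hO.measurableSet).2 h1
  have h3 := Measure.eqOn_open_of_ae_eq h2 hO hf.continuousOn continuousOn_const
  have h4 : IsClosed {z | f z = 0} := isClosed_eq hf continuous_const
  intro t ht x hx
  -- The zero set is closed and contains the open box, whose closure contains `[t₀, t₁] × M`: this
  -- needs `t₀ < t₁` and the density of the interior.
  refine closure_minimal (fun z hz => h3 hz) h4 ?_
  rw [closure_prod_eq, closure_Ioo h01.ne]
  exact ⟨ht, hM' hx⟩

/-- The two components of the generator are independent: `(g a, 0)` with a constant vector `a` tests
the momentum equation, `(0, g)` the tracer equation. -/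
theorem HamiltonPrinciple.affineEulerPoincare (hM : IsClosed M)
    (hM' : M ⊆ closure (interior M)) {s : ℝ} {ℓ : State M → ℝ} {t₀ t₁ : ℝ} (h01 : t₀ < t₁)
    (E : StateExtension q) (C : CostateExtension μ) (hC : IsC1Along ℓ t₀ t₁ q)
    (hμ : ∀ t ∈ Icc t₀ t₁, IsVariationalDerivative ℓ (q t) (μ t))
    (h : HamiltonPrinciple s ℓ t₀ t₁ q) : AffineEulerPoincare s t₀ t₁ q μ := by
  rw [affineEulerPoincare_iff hM' s t₀ t₁ E C]
  have hout : ∀ (g : ℝ × Plane → ℝ), ∀ z ∉ tsupport g, g z = 0 := fun g z hz =>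
    image_eq_zero_of_notMem_tsupport hz
  intro t ht x hx
  constructor
  · ext a
    refine eq_zero_of_forall_integral_eq_zero hM' h01 (f := fun z => resS E C z a)
      ((continuous_resS E C).clm_apply continuous_const) (fun g hg hgc hgs => ?_) t ht x hx
    have h1 := h.weak_form hM hM' h01.le E C hC hμ (V := fun z => g z • a) (W := fun _ => 0)
      (hg.smul contDiff_const) contDiff_const hgc hgs (fun z hz => by simp [hout g z hz])
      (fun _ _ => rfl)
    simpa using h1
  · refine eq_zero_of_forall_integral_eq_zero hM' h01 (f := resT s E C)
      (continuous_resT s E C) (fun g hg hgc hgs => ?_) t ht x hx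
    have h1 := h.weak_form hM hM' h01.le E C hC hμ (V := fun _ => 0) (W := g)
      contDiff_const hg hgc hgs (fun _ _ => rfl) (hout g)
    simpa [mul_comm] using h1

end Hamilton

end VSM

end

/-! ### The affine Euler–Poincaré theorem -/

open VSM in
theorem theorem2p1 (M : Set Plane) (hM : IsClosed M) (hM' : M ⊆ closure (interior M)) (s : ℝ) :
    -- the constrained variations follow from the definitions of the variables on the group
    (∀ g : ℝ × ℝ → SliceGroup M, SmoothGroupFamily g → ∀ (D₀ : Den M) (θ₀ : Fun M),
      ∃ (Q : ℝ × ℝ → State M) (v : ℝ → Alg M),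
        SmoothStateFamily Q ∧ SmoothAlgFamily v ∧
        (∀ e : ℝ, IsInducedBy s D₀ θ₀ (fun t => g (e, t)) (fun t => Q (e, t))) ∧
        IsGenerator g v ∧
        ∀ t : ℝ, velocity (fun e => Q (e, t)) 0 =
          constrainedVariation s (fun t => Q (0, t)) v t) ∧
    -- the coadjoint action and the diamonds are the duals of `ad` and of the Lie derivative
    (∀ (u v : Vec M) (m : OneFormDen M), BddSupp v →
      pairVec (adStar u m) (vval v) = pairVec (val m) (adVec u v)) ∧
    (∀ (v : Vec M) (b : Den M) (a : Fun M), BddSupp v →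
      - pairVec (diamondFun b a) (vval v) = pairFun (lieFun v a) (val b)) ∧
    (∀ (v : Vec M) (b : Fun M) (D : Den M), BddSupp v →
      - pairVec (diamondDen b D) (vval v) = pairFun (lieDen v D) (val b)) ∧
    -- Hamilton's principle is equivalent to the affine Euler–Poincaré equations
    (∀ (ℓ : State M → ℝ) (t₀ t₁ : ℝ), t₀ < t₁ →
      ∀ (q : ℝ → State M) (μ : ℝ → Costate M), SmoothStateFamily q → SmoothCostateFamily μ →
        IsC1Along ℓ t₀ t₁ q →
        (∀ t ∈ Set.Icc t₀ t₁, IsVariationalDerivative ℓ (q t) (μ t)) →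
        (HamiltonPrinciple s ℓ t₀ t₁ q ↔ AffineEulerPoincare s t₀ t₁ q μ)) := by
  refine ⟨fun g hg D₀ θ₀ => exists_constrainedVariation hM' s g hg D₀ θ₀,
    fun u v m hv => pairVec_adStar hM hM' u v m hv, fun v b a _ => pairVec_diamondFun v b a,
    fun v b D hv => pairVec_diamondDen hM hM' v b D hv, ?_⟩
  intro ℓ t₀ t₁ h01 q μ hq hμ hC hder
  obtain ⟨E⟩ := hq.nonempty_extension
  obtain ⟨C⟩ := hμ.nonempty_extension
  exact ⟨fun h => h.affineEulerPoincare hM hM' h01 E C hC hder,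
    hamiltonPrinciple_of_affineEulerPoincare hM hM' s h01.le E C hC hder⟩
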